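/- All polytopes are convex polytopes (convex hulls of finite sets of points); a $d$-polytope is a polytope of dimension $d$, and its facets are its faces of dimension $d-1$. A polytope is 2-neighborly if any two of its vertices form an edge. Two polytopes are combinatorially equivalent if their face lattices are isomorphic. A pyramid over a polytope $R$ is a polytope of the form $\mathrm{conv}(B\cup\{a\})$ with $B$ a polytope combinatorially equivalent to $R$ and $a$ a point outside the affine hull of $B$; for $k\ge 1$, a $k$-fold pyramid over $R$ is obtained by taking successive pyramids $k$ times, starting from a polytope combinatorially equivalent to $R$. Let $P_{5,8,12}\subset\mathbb{R}^5$ be the convex hull of the eight points $(0,0,0,0,0)$, $(0,0,0,0,1)$, $(0,0,0,1,0)$, $(0,0,1,0,0)$, $(0,1,0,0,1)$, $(0,1,1,1,0)$, $(1,0,0,1,0)$, $(1,0,1,0,1)$ (a 2-neighborly 5-polytope with 8 vertices and 12 facets). Proposition. Let $k\ge 1$ be an integer and let $Q$ be a $k$-fold pyramid over $P_{5,8,12}$. Let $P$ be a 2-neighborly $(k+6)$-polytope with at most $k+15$ facets that has at least one facet with at least $k+8$ vertices, and suppose that every facet of $P$ with at least $k+8$ vertices is combinatorially equivalent to $Q$.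 Then $P$ is a pyramid over $Q$. -/

import Mathlib

/-- Affine dimension of a set (intended for nonempty sets). -/
noncomputable def affDim {n : ℕ} (P : Set (EuclideanSpace ℝ (Fin n))) : ℕ :=
  Module.finrank ℝ (vectorSpan ℝ P)

/-- A (nonempty) convex polytope: the convex hull of a nonempty finite set of points. -/
def IsPolytope {n : ℕ} (P : Set (EuclideanSpace ℝ (Fin n))) : Prop :=
  ∃ S : Set (EuclideanSpace ℝ (Fin n)), S.Finite ∧ S.Nonempty ∧ P = convexHull ℝ S

/-- A `d`-polytope. -/
def IsDPolytope {n : ℕ} (d : ℕ) (P : Set (EuclideanSpace ℝ (Fin n))) : Prop :=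
  IsPolytope P ∧ affDim P = d

/-- The face lattice of `P`, ordered by inclusion: the faces are the sets of maximizers of linear
functionals (so `P` itself is a face), together with the empty set. -/
abbrev FaceLattice {n : ℕ} (P : Set (EuclideanSpace ℝ (Fin n))) : Type :=
  {F : Set (EuclideanSpace ℝ (Fin n)) // IsExposed ℝ P F}

/-- Combinatorial equivalence: the face lattices are isomorphic. -/
def CombEquiv {m n : ℕ} (P : Set (EuclideanSpace ℝ (Fin m)))
    (Q : Set (EuclideanSpace ℝ (Fin n))) : Prop :=
  Nonempty (FaceLattice P ≃o FaceLattice Q)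

/-- The vertices of `P`. -/
def vertexSet {n : ℕ} (P : Set (EuclideanSpace ℝ (Fin n))) : Set (EuclideanSpace ℝ (Fin n)) :=
  P.extremePoints ℝ

/-- The facets of `P`: the nonempty faces of codimension one. -/
def facetSet {n : ℕ} (P : Set (EuclideanSpace ℝ (Fin n))) :
    Set (Set (EuclideanSpace ℝ (Fin n))) :=
  {F | IsExposed ℝ P F ∧ F.Nonempty ∧ affDim F + 1 = affDim P}

/-- `P` is 2-neighborly: the segment between any two vertices is a face of `P`. -/
def IsTwoNeighborly {n : ℕ} (P : Set (EuclideanSpace ℝ (Fin n))) : Prop :=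
  ∀ x ∈ vertexSet P, ∀ y ∈ vertexSet P, x ≠ y → IsExposed ℝ P (segment ℝ x y)

/-- `P` is a pyramid with base the polytope `B` (an apex being a point off the affine hull
of `B`). -/
def IsPyramidWithBase {n : ℕ} (P B : Set (EuclideanSpace ℝ (Fin n))) : Prop :=
  IsPolytope B ∧ ∃ a : EuclideanSpace ℝ (Fin n),
    a ∉ affineSpan ℝ B ∧ P = convexHull ℝ (insert a B)

/-- `P` is a `k`-fold pyramid over (a polytope combinatorially equivalent to) the polytope `Q`. -/
def IsKFoldPyramidOver {m n : ℕ} (Q : Set (EuclideanSpace ℝ (Fin m))) :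
    ℕ → Set (EuclideanSpace ℝ (Fin n)) → Prop
  | 0, P => IsPolytope P ∧ CombEquiv P Q
  | k + 1, P => ∃ B, IsPyramidWithBase P B ∧ IsKFoldPyramidOver Q k B

/-- `P` is a pyramid over (a polytope combinatorially equivalent to) the polytope `Q`. -/
def IsPyramidOver {m n : ℕ} (P : Set (EuclideanSpace ℝ (Fin n)))
    (Q : Set (EuclideanSpace ℝ (Fin m))) : Prop :=
  ∃ B, IsPyramidWithBase P B ∧ CombEquiv B Q

/-- The 0/1-polytope `P_{5,8,12}`, a 5-polytope with 8 vertices and 12 facets. -/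
def P5812 : Set (EuclideanSpace ℝ (Fin 5)) :=
  convexHull ℝ
    {!₂[0, 0, 0, 0, 0],
     !₂[0, 0, 0, 0, 1],
     !₂[0, 0, 0, 1, 0],
     !₂[0, 0, 1, 0, 0],
     !₂[0, 1, 0, 0, 1],
     !₂[0, 1, 1, 1, 0],
     !₂[1, 0, 0, 1, 0],
     !₂[1, 0, 1, 0, 1]}

/-!
Call a facet of `P` large if it has at least `k + 8` vertices. A large facet `F` is a pyramid over a
ridge `R`, with apex `a`. The other facet through `R` is large as well, and so has just one vertex
`b` outside `R`. Since `F` has at least `k + 12` facets and `P` at most `k + 15`, at most two facets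
of `P` do not meet `F` in a facet of `F`; call these far. If `P` is not a pyramid, neither all
vertices but `a` nor all vertices but `b` form a facet, and then 2-neighborliness, applied to `a`,
`b` and a vertex `c` outside both pyramids, yields two things: no far facet contains `a`, and some
facet `S₁` of `F` lies in a second facet `W` of `P` that avoids `b`. Each such `S₁` gives rise to a
different far facet, so there are at most two of them.

The incidences between vertices and facets of `P_{5,8,12}`, which are inherited by iterated
pyramids, now produce a facet `T` of `F` with all but two of its vertices that is adjacent to `S₁`
and whose second facet `X` contains `b`. Among the facets through `S₁ ∩ T` only `F`, `W` and `X` are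
available, so `W` and `X` share a vertex outside `F`, which is not `b`. Hence `X` is large, but it
contains the two facets `T` and `conv (T \ {a} ∪ {b})`, each missing only two of its vertices, whose
intersection is larger than it can be in a large facet.
-/

section ExposedFaces

theorem isExposed_setOf_eq {𝕜 E : Type*} [TopologicalSpace 𝕜] [Semiring 𝕜] [PartialOrder 𝕜]
    [AddCommMonoid E] [TopologicalSpace E] [Module 𝕜 E] {P : Set E} (l : StrongDual 𝕜 E) {c : 𝕜}
    (hl : ∀ y ∈ P, l y ≤ c) : IsExposed 𝕜 P {y ∈ P | l y = c} := by
  rintro ⟨w, hwP, hw⟩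
  exact ⟨l, Set.Subset.antisymm (fun x hx => ⟨hx.1, fun y hy => hx.2 ▸ hl y hy⟩)
    fun x hx => ⟨hx.1, le_antisymm (hl x hx.1) (hw ▸ hx.2 w hwP)⟩⟩

theorem exists_mem_iff_of_isExposed {𝕜 E : Type*} [TopologicalSpace 𝕜] [Semiring 𝕜]
    [PartialOrder 𝕜] [AddCommMonoid E] [TopologicalSpace E] [Module 𝕜 E] {P X : Set E}
    (hX : IsExposed 𝕜 P X) (hne : X.Nonempty) :
    ∃ (l : StrongDual 𝕜 E) (c : 𝕜), (∀ y ∈ P, l y ≤ c) ∧ ∀ y, y ∈ X ↔ y ∈ P ∧ l y = c := by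
  obtain ⟨l, rfl⟩ := hX hne
  obtain ⟨w, hwP, hw⟩ := hne
  exact ⟨l, l w, hw, fun y => ⟨fun hy => ⟨hy.1, le_antisymm (hw y hy.1) (hy.2 w hwP)⟩,
    fun hy => ⟨hy.1, fun z hz => hy.2 ▸ hw z hz⟩⟩⟩

theorem exists_pos_forall_add_mul_neg {α : Type*} {S : Set α} (hS : S.Finite) (u w : α → ℝ) :
    ∃ ε > 0, ∀ s ∈ S, u s < 0 → u s + ε * w s < 0 := by
  have hev : ∀ᶠ ε in nhdsWithin (0 : ℝ) (Set.Ioi 0), ∀ s ∈ S, u s < 0 → u s + ε * w s < 0 :=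
    hS.eventually_all.2 fun s _ => Filter.eventually_imp_distrib_left.2 fun hs =>
      nhdsWithin_le_nhds <| ContinuousAt.eventually_lt (by fun_prop) continuousAt_const (by simpa)
  obtain ⟨ε, hε, hpos⟩ := (hev.and self_mem_nhdsWithin).exists
  exact ⟨ε, hpos, hε⟩

theorem exists_forall_add_mul_nonpos_of_finite {α 𝕜 : Type*} [Field 𝕜] [LinearOrder 𝕜]
    [IsStrictOrderedRing 𝕜] {S : Set α} (hS : S.Finite) {u w : α → 𝕜} (hu : ∀ s ∈ S, u s ≤ 0)
    (huw : ∀ s ∈ S, u s = 0 → w s ≤ 0) (hw : ∃ s ∈ S, 0 < w s) :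
    ∃ t : 𝕜, (∀ s ∈ S, u s + t * w s ≤ 0) ∧ ∃ s ∈ S, u s < 0 ∧ u s + t * w s = 0 := by
  obtain ⟨s, ⟨hs, hws⟩, hmin⟩ := Set.exists_min_image {s ∈ S | 0 < w s}
    (fun s => -u s / w s) (hS.subset (Set.sep_subset _ _)) hw
  have hus : u s < 0 := (hu s hs).lt_of_ne fun h => (huw s hs h).not_gt hws
  have ht : 0 < -u s / w s := div_pos (neg_pos.2 hus) hws
  refine ⟨-u s / w s, fun y hy => ?_, s, hs, hus, by field_simp; ring⟩
  rcases le_or_gt (w y) 0 with h | h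
  · linarith [hu y hy, mul_nonpos_of_nonneg_of_nonpos ht.le h]
  · linarith [(le_div_iff₀ h).1 (hmin y ⟨hy, h⟩)]

theorem map_eq_zero_of_mem_vectorSpan {k V : Type*} [Ring k] [AddCommGroup V] [Module k V]
    {S : Set V} (f : V →ₗ[k] k) {c : k} (hf : ∀ y ∈ S, f y = c) {v : V}
    (hv : v ∈ vectorSpan k S) : f v = 0 := by
  suffices vectorSpan k S ≤ LinearMap.ker f from this hv
  rw [vectorSpan, Submodule.span_le]
  rintro _ ⟨p, hp, q, hq, rfl⟩
  simp [hf p hp, hf q hq]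

theorem exists_forall_eq_and_lt_of_not_vectorSpan_le {E : Type*} [NormedAddCommGroup E]
    [NormedSpace ℝ E] [FiniteDimensional ℝ E] {P S : Set E} {x : E} (hx : x ∈ S)
    (h : ¬ vectorSpan ℝ P ≤ vectorSpan ℝ S) :
    ∃ g : StrongDual ℝ E, (∀ y ∈ S, g y = g x) ∧ ∃ y ∈ P, g x < g y := by
  obtain ⟨w, hwP, hwS⟩ := SetLike.not_le_iff_exists.1 h
  obtain ⟨f, hfw, hf⟩ := Submodule.exists_dual_map_eq_bot_of_notMem hwS inferInstance
  have hfS : ∀ y ∈ S, f y = f x := fun y hy => by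
    have hyx : f (y - x) ∈ (vectorSpan ℝ S).map f :=
      Submodule.mem_map_of_mem (vsub_mem_vectorSpan ℝ hy hx)
    rwa [hf, Submodule.mem_bot, map_sub, sub_eq_zero] at hyx
  obtain ⟨y, hyP, hyx⟩ : ∃ y ∈ P, f y ≠ f x := by
    by_contra! hconst
    exact hfw (map_eq_zero_of_mem_vectorSpan f hconst hwP)
  rcases hyx.lt_or_gt with hlt | hlt
  · exact ⟨LinearMap.toContinuousLinearMap (-f), by simpa using hfS, y, hyP, by simpa using hlt⟩
  · exact ⟨LinearMap.toContinuousLinearMap f, hfS, y, hyP, hlt⟩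

end ExposedFaces

section Polytopes

variable {n : ℕ} {P X Y A E F G H : Set (EuclideanSpace ℝ (Fin n))}

theorem vertexSet_eq_inter (hX : IsExposed ℝ P X) : vertexSet X = X ∩ vertexSet P :=
  hX.isExtreme.extremePoints_eq

namespace IsPolytope

theorem isCompact (hP : IsPolytope P) : IsCompact P := by
  obtain ⟨S, hS, -, rfl⟩ := hP
  exact hS.isCompact_convexHull ℝ

theorem convex (hP : IsPolytope P) : Convex ℝ P := by
  obtain ⟨S, -, -, rfl⟩ := hP
  exact convex_convexHull ℝ S

theorem nonempty (hP : IsPolytope P) : P.Nonempty := by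
  obtain ⟨S, -, hS, rfl⟩ := hP
  exact hS.convexHull

theorem finite_vertexSet (hP : IsPolytope P) : (vertexSet P).Finite := by
  obtain ⟨S, hS, -, rfl⟩ := hP
  exact hS.subset extremePoints_convexHull_subset

theorem finite_vertexSet_face (hP : IsPolytope P) (hX : IsExposed ℝ P X) :
    (vertexSet X).Finite :=
  hP.finite_vertexSet.subset (vertexSet_eq_inter hX ▸ Set.inter_subset_right)

theorem face_eq_convexHull (hP : IsPolytope P) (hX : IsExposed ℝ P X) :
    X = convexHull ℝ (vertexSet X) :=
  (closure_convexHull_extremePoints (hX.isCompact hP.isCompact) (hX.convex hP.convex)).symm.trans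
    ((hP.finite_vertexSet_face hX).isClosed_convexHull ℝ).closure_eq

theorem eq_convexHull (hP : IsPolytope P) : P = convexHull ℝ (vertexSet P) :=
  hP.face_eq_convexHull (IsExposed.refl P)

theorem face (hP : IsPolytope P) (hX : IsExposed ℝ P X) (hne : X.Nonempty) : IsPolytope X :=
  ⟨vertexSet X, hP.finite_vertexSet_face hX,
    (hX.isCompact hP.isCompact).extremePoints_nonempty hne, hP.face_eq_convexHull hX⟩

theorem subset_iff (hP : IsPolytope P) (hX : IsExposed ℝ P X) (hY : IsExposed ℝ P Y) :
    X ⊆ Y ↔ vertexSet X ⊆ vertexSet Y := by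
  constructor
  · intro h
    rw [vertexSet_eq_inter hX, vertexSet_eq_inter hY]
    exact Set.inter_subset_inter_left _ h
  · intro h
    rw [hP.face_eq_convexHull hX, hP.face_eq_convexHull hY]
    exact convexHull_mono h

theorem le_of_forall_vertexSet (hP : IsPolytope P) (l : StrongDual ℝ (EuclideanSpace ℝ (Fin n)))
    {c : ℝ} (h : ∀ v ∈ vertexSet P, l v ≤ c) : ∀ y ∈ P, l y ≤ c := by
  intro y hy
  rw [hP.eq_convexHull] at hy
  exact convexHull_min (t := {y | l y ≤ c}) h (convex_halfSpace_le l.toLinearMap.isLinear c) hy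

theorem isExposed_convexHull (hP : IsPolytope P) (l : StrongDual ℝ (EuclideanSpace ℝ (Fin n)))
    {c : ℝ} (h : ∀ v ∈ vertexSet P, l v ≤ c) :
    IsExposed ℝ P (convexHull ℝ {v ∈ vertexSet P | l v = c}) := by
  have hface := isExposed_setOf_eq l (hP.le_of_forall_vertexSet l h)
  have hvertex : vertexSet {y ∈ P | l y = c} = {v ∈ vertexSet P | l v = c} := by
    rw [vertexSet_eq_inter hface]
    ext v
    exact ⟨fun hv => ⟨hv.2, hv.1.2⟩, fun hv => ⟨⟨hv.1.1, hv.2⟩, hv.1⟩⟩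
  rwa [← hvertex, ← hP.face_eq_convexHull hface]

theorem isExposed_trans (hP : IsPolytope P) (hX : IsExposed ℝ P X) (hY : IsExposed ℝ X Y) :
    IsExposed ℝ P Y := by
  rcases Y.eq_empty_or_nonempty with rfl | hne
  · exact isExposed_empty
  have hXp := hP.face hX (hne.mono hY.subset)
  obtain ⟨l, c, hl, mem_X⟩ := exists_mem_iff_of_isExposed hX hXp.nonempty
  obtain ⟨g, d, hg, mem_Y⟩ := exists_mem_iff_of_isExposed hY hne
  -- A small multiple of `g` breaks the ties of `l` on `X` without moving the maximum off `X`.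
  obtain ⟨ε, hε, hlt⟩ := exists_pos_forall_add_mul_neg hP.finite_vertexSet
    (fun v => l v - c) (fun v => g v - d)
  have apply_eq (v) : (l + ε • g) v = l v + ε * g v := by simp
  have h := hP.isExposed_convexHull (l + ε • g) (c := c + ε * d) fun v hv => by
    rw [apply_eq]
    rcases (hl v hv.1).lt_or_eq with h | h
    · linarith [hlt v hv (by linarith)]
    · rw [h]
      gcongr
      exact hg v ((mem_X v).2 ⟨hv.1, h⟩)
  convert h
  rw [hXp.face_eq_convexHull hY, vertexSet_eq_inter hY, vertexSet_eq_inter hX]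
  congr 1
  ext v
  simp only [Set.mem_inter_iff, Set.mem_ofPred_eq, apply_eq, mem_X, mem_Y]
  constructor
  · rintro ⟨⟨⟨-, hlv⟩, hgv⟩, -, hv⟩
    exact ⟨hv, by rw [hlv, hgv]⟩
  · rintro ⟨hv, hsum⟩
    have hlv : l v = c := (hl v hv.1).eq_of_not_lt fun h => by linarith [hlt v hv (by linarith)]
    rw [hlv, add_right_inj, mul_right_inj' hε.ne'] at hsum
    exact ⟨⟨⟨hv.1, hlv⟩, hsum⟩, ⟨hv.1, hlv⟩, hv⟩

theorem isExposed_singleton (hP : IsPolytope P) {x : EuclideanSpace ℝ (Fin n)}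
    (hx : x ∈ vertexSet P) : IsExposed ℝ P {x} := by
  have hnot : x ∉ convexHull ℝ (vertexSet P \ {x}) := fun h =>
    (hP.convex.mem_extremePoints_iff_mem_sdiff_convexHull_sdiff.1 hx).2
      (convexHull_mono (Set.sdiff_subset_sdiff_left extremePoints_subset) h)
  obtain ⟨l, u, hlu, hux⟩ := geometric_hahn_banach_closed_point (convex_convexHull ℝ _)
    ((hP.finite_vertexSet.subset Set.sdiff_subset).isClosed_convexHull ℝ) hnot
  have hlt : ∀ y ∈ vertexSet P, y ≠ x → l y < l x := fun y hy hne =>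
    (hlu y (subset_convexHull ℝ _ ⟨hy, hne⟩)).trans hux
  have hle : ∀ y ∈ vertexSet P, l y ≤ l x := fun y hy => by
    rcases eq_or_ne y x with rfl | hne
    exacts [le_rfl, (hlt y hy hne).le]
  have hargmax : {y ∈ vertexSet P | l y = l x} = {x} :=
    Set.Subset.antisymm (fun y hy => by_contra fun hne => (hlt y hy.1 hne).ne hy.2)
      (Set.singleton_subset_iff.2 ⟨hx, rfl⟩)
  simpa only [hargmax, convexHull_singleton] using hP.isExposed_convexHull l hle

end IsPolytope

theorem affDim_lt_of_isExposed (hX : IsExposed ℝ P X) (hne : X.Nonempty) (hXP : X ≠ P) :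
    affDim X < affDim P := by
  by_contra! hle
  obtain ⟨l, c, -, mem_X⟩ := exists_mem_iff_of_isExposed hX hne
  have hspan : vectorSpan ℝ X = vectorSpan ℝ P :=
    Submodule.eq_of_le_of_finrank_le (vectorSpan_mono ℝ hX.subset) hle
  refine hXP (hX.subset.antisymm fun y hy => ?_)
  obtain ⟨x, hx⟩ := hne
  have hyx : l.toLinearMap (y - x) = 0 :=
    map_eq_zero_of_mem_vectorSpan _ (fun z hz => ((mem_X z).1 hz).2)
      (hspan ▸ vsub_mem_vectorSpan ℝ hy (hX.subset hx))
  exact (mem_X y).2 ⟨hy, by simpa [sub_eq_zero, ((mem_X x).1 hx).2] using hyx⟩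

theorem ne_of_mem_facetSet (hX : X ∈ facetSet P) : X ≠ P := by
  rintro rfl
  exact absurd hX.2.2 (by omega)

theorem eq_of_mem_facetSet_of_subset (hX : X ∈ facetSet P) (hY : IsExposed ℝ P Y) (hYP : Y ≠ P)
    (hXY : X ⊆ Y) : X = Y := by
  by_contra hne
  have hXdim := affDim_lt_of_isExposed (hX.1.mono hY.subset hXY) hX.2.1 hne
  have hYdim := affDim_lt_of_isExposed hY (hX.2.1.mono hXY) hYP
  have := hX.2.2
  omega

theorem IsPolytope.exists_isExposed_ssuperset (hP : IsPolytope P) (hA : IsExposed ℝ P A)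
    (hne : A.Nonempty) {x : EuclideanSpace ℝ (Fin n)} (hxP : x ∈ P) (hxA : x ∉ A)
    (hdim : affDim A + 1 < affDim P) :
    ∃ B, IsExposed ℝ P B ∧ A ⊂ B ∧ x ∉ B := by
  obtain ⟨l, c, hl, mem_A⟩ := exists_mem_iff_of_isExposed hA hne
  have hnot : ¬ vectorSpan ℝ P ≤ vectorSpan ℝ (insert x A) := fun h => by
    have h₁ := Submodule.finrank_mono h
    have h₂ := finrank_vectorSpan_insert_le_set ℝ A x
    unfold affDim at hdim
    omega
  -- Tilting the hyperplane that exposes `A` about `A ∪ {x}` until it meets another vertex.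
  obtain ⟨g, hg, y, hyP, hgy⟩ :=
    exists_forall_eq_and_lt_of_not_vectorSpan_le (Set.mem_insert x A) hnot
  have hgA : ∀ y ∈ A, g y = g x := fun y hy => hg y (Set.mem_insert_of_mem x hy)
  obtain ⟨t, hle, s, hsP, hls, hst⟩ := exists_forall_add_mul_nonpos_of_finite hP.finite_vertexSet
    (u := fun v => l v - c) (w := fun v => g v - g x) (fun v hv => sub_nonpos.2 (hl v hv.1))
    (fun v hv h => (sub_eq_zero.2 (hgA v ((mem_A v).2 ⟨hv.1, sub_eq_zero.1 h⟩))).le) (by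
      by_contra! h
      exact hgy.not_ge (hP.le_of_forall_vertexSet g (fun v hv => sub_nonpos.1 (h v hv)) y hyP))
  have apply_eq (v) : (l + t • g) v = l v + t * g v := by simp
  have hB := isExposed_setOf_eq (l + t • g) (c := c + t * g x)
    (hP.le_of_forall_vertexSet _ fun v hv => by rw [apply_eq]; linarith [hle v hv])
  refine ⟨_, hB, ⟨fun y hy => ⟨hA.subset hy, ?_⟩, fun hBA => ?_⟩, fun hxB => hxA ?_⟩
  · rw [apply_eq, hgA y hy, ((mem_A y).1 hy).2]
  · have hs := (mem_A s).1 (hBA ⟨hsP.1, by rw [apply_eq]; linarith⟩)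
    linarith [hs.2]
  · exact (mem_A x).2 ⟨hxP, by simpa using hxB.2⟩

theorem IsPolytope.exists_mem_facetSet_of_nonempty (hP : IsPolytope P) (hA : IsExposed ℝ P A)
    (hne : A.Nonempty) {x : EuclideanSpace ℝ (Fin n)} (hxP : x ∈ P) (hxA : x ∉ A) :
    ∃ H ∈ facetSet P, A ⊆ H ∧ x ∉ H := by
  induction hk : affDim P - affDim A using Nat.strong_induction_on generalizing A with
  | _ k ih =>
    have hAP := affDim_lt_of_isExposed hA hne fun h => hxA (h ▸ hxP)
    by_cases hd : affDim A + 1 = affDim P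
    · exact ⟨A, ⟨hA, hne, hd⟩, subset_rfl, hxA⟩
    · obtain ⟨B, hB, hAB, hxB⟩ := hP.exists_isExposed_ssuperset hA hne hxP hxA (by omega)
      have hBdim := affDim_lt_of_isExposed (hA.mono hB.subset hAB.subset) hne hAB.ne
      obtain ⟨H, hH, hBH, hxH⟩ := ih _ (by omega) hB (hne.mono hAB.subset) hxB rfl
      exact ⟨H, hH, hAB.subset.trans hBH, hxH⟩

theorem IsPolytope.exists_mem_facetSet (hP : IsPolytope P) (hd : 1 ≤ affDim P)
    (hA : IsExposed ℝ P A) {x : EuclideanSpace ℝ (Fin n)} (hxP : x ∈ P) (hxA : x ∉ A) :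
    ∃ H ∈ facetSet P, A ⊆ H ∧ x ∉ H := by
  rcases A.eq_empty_or_nonempty with rfl | hne
  · obtain ⟨y, hy, hyx⟩ : ∃ y ∈ vertexSet P, y ≠ x := by
      by_contra! h
      have hPx : P ⊆ {x} := by
        rw [hP.eq_convexHull, ← convexHull_singleton (𝕜 := ℝ) x]
        exact convexHull_mono h
      have hle := Submodule.finrank_mono (vectorSpan_mono ℝ hPx)
      rw [vectorSpan_singleton, finrank_bot] at hle
      unfold affDim at hd
      omega
    obtain ⟨H, hH, -, hxH⟩ := hP.exists_mem_facetSet_of_nonempty (hP.isExposed_singleton hy)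
      (Set.singleton_nonempty y) hxP hyx.symm
    exact ⟨H, hH, Set.empty_subset _, hxH⟩
  · exact hP.exists_mem_facetSet_of_nonempty hA hne hxP hxA

theorem exists_eq_add_smul_of_mem_facetSet (hF : F ∈ facetSet P)
    {e g v : EuclideanSpace ℝ (Fin n)} (he : e ∈ F) (hg : g ∈ P) (hgF : g ∉ F)
    (hv : v ∈ vectorSpan ℝ P) : ∃ u ∈ vectorSpan ℝ F, ∃ β : ℝ, v = u + β • (g - e) := by
  obtain ⟨l, c, -, mem_F⟩ := exists_mem_iff_of_isExposed hF.1 ⟨e, he⟩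
  have hge : g - e ∉ vectorSpan ℝ F := fun h => hgF <| (mem_F g).2 ⟨hg, by
    have := map_eq_zero_of_mem_vectorSpan l.toLinearMap (fun y hy => ((mem_F y).1 hy).2) h
    simpa [sub_eq_zero, ((mem_F e).1 he).2] using this⟩
  have hge' : g - e ∈ vectorSpan ℝ P := vsub_mem_vectorSpan ℝ hg (hF.1.subset he)
  have hlt : vectorSpan ℝ F < vectorSpan ℝ F ⊔ ℝ ∙ (g - e) :=
    left_lt_sup.2 fun h => hge (h (Submodule.mem_span_singleton_self _))
  have hspan : vectorSpan ℝ F ⊔ ℝ ∙ (g - e) = vectorSpan ℝ P :=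
    Submodule.eq_of_le_of_finrank_le
      (sup_le (vectorSpan_mono ℝ hF.1.subset) ((Submodule.span_singleton_le_iff_mem _ _).2 hge'))
      (hF.2.2.symm.le.trans (Submodule.finrank_lt_finrank_of_lt hlt))
  rw [← hspan] at hv
  obtain ⟨u, hu, w, hw, rfl⟩ := Submodule.mem_sup.1 hv
  obtain ⟨β, rfl⟩ := Submodule.mem_span_singleton.1 hw
  exact ⟨u, hu, β, rfl⟩

theorem inter_eq_of_mem_facetSet_of_subset (hF : F ∈ facetSet P) (hG : G ∈ facetSet P)
    (hFG : G ≠ F) (hE : E ∈ facetSet F) (hEG : E ⊆ G) : F ∩ G = E := by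
  refine (eq_of_mem_facetSet_of_subset hE ((hF.1.inter hG.1).mono hF.1.subset
    Set.inter_subset_left) (fun h => hFG ?_) (Set.subset_inter hE.1.subset hEG)).symm
  exact (eq_of_mem_facetSet_of_subset hF hG.1 (ne_of_mem_facetSet hG) (Set.inter_eq_left.1 h)).symm

theorem exists_apply_sub_eq_of_mem_facetSet (hF : F ∈ facetSet P) (hE : E ∈ facetSet F)
    {f g h : EuclideanSpace ℝ (Fin n)} (hf : f ∈ F) (hfE : f ∉ E) (hg : g ∈ P) (hgF : g ∉ F)
    (hh : h ∈ P) :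
    ∃ α β : ℝ, ∀ (l : StrongDual ℝ (EuclideanSpace ℝ (Fin n))) (c : ℝ), (∀ y ∈ E, l y = c) →
      l h - c = α * (l f - c) + β * (l g - c) := by
  obtain ⟨e, he⟩ := hE.2.1
  have heF := hE.1.subset he
  obtain ⟨u', hu', β, hβ⟩ := exists_eq_add_smul_of_mem_facetSet hF heF hg hgF
    (vsub_mem_vectorSpan ℝ hh (hF.1.subset heF))
  obtain ⟨u, hu, α, rfl⟩ := exists_eq_add_smul_of_mem_facetSet hE he hf hfE hu'
  refine ⟨α, β, fun l c hl => ?_⟩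
  have hlu : l u = 0 := map_eq_zero_of_mem_vectorSpan l.toLinearMap hl hu
  simpa [hlu, hl e he] using congrArg l hβ

theorem eq_of_mem_facetSet_of_ridge_subset (hF : F ∈ facetSet P) (hG : G ∈ facetSet P)
    (hH : H ∈ facetSet P) (hGF : G ≠ F) (hHF : H ≠ F) (hE : E ∈ facetSet F) (hEG : E ⊆ G)
    (hEH : E ⊆ H) : G = H := by
  have hFG := inter_eq_of_mem_facetSet_of_subset hF hG hGF hE hEG
  refine eq_of_mem_facetSet_of_subset hG hH.1 (ne_of_mem_facetSet hH) fun g hg => ?_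
  by_cases hgF : g ∈ F
  · exact hEH (hFG ▸ ⟨hgF, hg⟩)
  obtain ⟨f, hf, hfE⟩ := Set.exists_of_ssubset (hE.1.subset.ssubset_of_ne (ne_of_mem_facetSet hE))
  obtain ⟨h, hh, hhF⟩ : ∃ h ∈ H, h ∉ F := Set.not_subset.1 fun hsub =>
    hHF (eq_of_mem_facetSet_of_subset hH hF.1 (ne_of_mem_facetSet hF) hsub)
  -- Modulo the directions of `E`, the point `h` has coordinates `α` along `f` and `β` along `g`.
  -- The inequalities of `F` and `G` give `0 < β` and `0 ≤ α`, so that of `H` is tight at `g`.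
  obtain ⟨α, β, hcomb⟩ := exists_apply_sub_eq_of_mem_facetSet hF hE hf hfE (hG.1.subset hg) hgF
    (hH.1.subset hh)
  obtain ⟨lF, cF, hlF, mem_F⟩ := exists_mem_iff_of_isExposed hF.1 hF.2.1
  obtain ⟨lG, cG, hlG, mem_G⟩ := exists_mem_iff_of_isExposed hG.1 hG.2.1
  obtain ⟨lH, cH, hlH, mem_H⟩ := exists_mem_iff_of_isExposed hH.1 hH.2.1
  have hβ : 0 < β := by
    have hlt {y} (hy : y ∈ P) (hyF : y ∉ F) : lF y < cF :=
      (hlF y hy).lt_of_ne fun h => hyF ((mem_F y).2 ⟨hy, h⟩)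
    have heq := hcomb lF cF fun y hy => ((mem_F y).1 (hE.1.subset hy)).2
    rw [((mem_F f).1 hf).2, sub_self, mul_zero, zero_add] at heq
    nlinarith [hlt (hH.1.subset hh) hhF, hlt (hG.1.subset hg) hgF]
  have hα : 0 ≤ α := by
    have hfG : lG f < cG := (hlG f (hF.1.subset hf)).lt_of_ne fun h =>
      hfE (hFG ▸ ⟨hf, (mem_G f).2 ⟨hF.1.subset hf, h⟩⟩)
    have heq := hcomb lG cG fun y hy => ((mem_G y).1 (hEG hy)).2
    rw [((mem_G g).1 hg).2, sub_self, mul_zero, add_zero] at heq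
    nlinarith [hlG h (hH.1.subset hh)]
  have heq := hcomb lH cH fun y hy => ((mem_H y).1 (hEH hy)).2
  rw [((mem_H h).1 hh).2, sub_self] at heq
  refine (mem_H g).2 ⟨hG.1.subset hg, (hlH g (hG.1.subset hg)).antisymm ?_⟩
  nlinarith [hlH f (hF.1.subset hf)]

end Polytopes

section FaceFamilies

open Finset

variable {α : Type*} {𝓕 : Set (Finset α)} {V A E F G H : Finset α} {x : α}

/-- The facets of `H` in a family `𝓕` of vertex sets of faces: the maximal members of `𝓕` that are
properly contained in `H`. -/
def facets (𝓕 : Set (Finset α)) (H : Finset α) : Set (Finset α) :=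
  {E | Maximal (fun X => X ∈ 𝓕 ∧ X ⊂ H) E}

/-- The combinatorial axioms satisfied by the family `𝓕` of the vertex sets of the faces of a
polytope with vertex set `V`. The last one says that a ridge lies in only two facets. -/
structure IsFaceFamily [DecidableEq α] (𝓕 : Set (Finset α)) (V : Finset α) : Prop where
  top_mem : V ∈ 𝓕
  inter_mem : ∀ A ∈ 𝓕, ∀ B ∈ 𝓕, A ∩ B ∈ 𝓕
  exists_facet : ∀ A ∈ 𝓕, ∀ H ∈ 𝓕, A ⊆ H → ∀ x ∈ H, x ∉ A → ∃ E ∈ facets 𝓕 H, A ⊆ E ∧ x ∉ E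
  eq_of_ridge_subset : ∀ F ∈ facets 𝓕 V, ∀ G ∈ facets 𝓕 V, ∀ H ∈ facets 𝓕 V, G ≠ F → H ≠ F →
    ∀ E ∈ facets 𝓕 F, E ⊆ G → E ⊆ H → G = H

theorem mem_of_mem_facets (hE : E ∈ facets 𝓕 H) : E ∈ 𝓕 :=
  hE.1.1

theorem ssubset_of_mem_facets (hE : E ∈ facets 𝓕 H) : E ⊂ H :=
  hE.1.2

theorem subset_of_mem_facets (hE : E ∈ facets 𝓕 H) : E ⊆ H :=
  hE.1.2.subset

theorem eq_of_mem_facets_of_subset (hE : E ∈ facets 𝓕 H) (hA : A ∈ 𝓕) (hAH : A ⊂ H)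
    (hEA : E ⊆ A) : E = A :=
  Maximal.eq_of_le (P := fun X => X ∈ 𝓕 ∧ X ⊂ H) hE ⟨hA, hAH⟩ hEA

theorem eq_of_mem_facets_of_mem_facets (hE : E ∈ facets 𝓕 H) (hA : A ∈ facets 𝓕 H)
    (hEA : E ⊆ A) : E = A :=
  eq_of_mem_facets_of_subset hE hA.1.1 hA.1.2 hEA

namespace IsFaceFamily

variable [DecidableEq α]

theorem inter_eq (h : IsFaceFamily 𝓕 V) (hF : F ∈ facets 𝓕 V) (hH : H ∈ facets 𝓕 V) (hHF : H ≠ F)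
    (hE : E ∈ facets 𝓕 F) (hEH : E ⊆ H) : F ∩ H = E := by
  refine (eq_of_mem_facets_of_subset hE (h.inter_mem F (mem_of_mem_facets hF) H
    (mem_of_mem_facets hH)) (inter_subset_left.ssubset_of_ne fun hFH => hHF ?_)
    (subset_inter (subset_of_mem_facets hE) hEH)).symm
  exact (eq_of_mem_facets_of_mem_facets hF hH (inter_eq_left.1 hFH)).symm

theorem exists_inter_eq (h : IsFaceFamily 𝓕 V) (hF : F ∈ facets 𝓕 V) (hE : E ∈ facets 𝓕 F) :
    ∃ H ∈ facets 𝓕 V, H ≠ F ∧ F ∩ H = E := by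
  obtain ⟨x, hxF, hxE⟩ := exists_of_ssubset (ssubset_of_mem_facets hE)
  have hFV := subset_of_mem_facets hF
  obtain ⟨H, hH, hEH, hxH⟩ := h.exists_facet E (mem_of_mem_facets hE) V h.top_mem
    ((subset_of_mem_facets hE).trans hFV) x (hFV hxF) hxE
  have hHF : H ≠ F := fun hHF => hxH (hHF ▸ hxF)
  exact ⟨H, hH, hHF, h.inter_eq hF hH hHF hE hEH⟩

theorem exists_facet_ne (h : IsFaceFamily 𝓕 V) (hF : F ∈ 𝓕) (hE : E ∈ facets 𝓕 F) (hA : A ∈ 𝓕)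
    (hAE : A ⊂ E) : ∃ E' ∈ facets 𝓕 F, E' ≠ E ∧ A ⊆ E' := by
  obtain ⟨x, hxE, hxA⟩ := exists_of_ssubset hAE
  have hEF := subset_of_mem_facets hE
  obtain ⟨E', hE', hAE', hxE'⟩ := h.exists_facet A hA F hF (hAE.subset.trans hEF) x (hEF hxE) hxA
  exact ⟨E', hE', fun hEE' => hxE' (hEE' ▸ hxE), hAE'⟩

theorem mem_facets_of_subset (h : IsFaceFamily 𝓕 V) (hF : F ∈ facets 𝓕 V) (hH : H ∈ facets 𝓕 V)
    (hHF : H ≠ F) (hE : E ∈ facets 𝓕 F) (hEH : E ⊆ H) : E ∈ facets 𝓕 H := by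
  have hFH := h.inter_eq hF hH hHF hE hEH
  obtain ⟨x, hxH, hxE⟩ : ∃ x ∈ H, x ∉ E := not_subset.1 fun hHE =>
    hHF (eq_of_mem_facets_of_mem_facets hH hF (hHE.trans (subset_of_mem_facets hE)))
  obtain ⟨E', hE', hEE', -⟩ := h.exists_facet E (mem_of_mem_facets hE) H (mem_of_mem_facets hH)
    hEH x hxH hxE
  obtain ⟨K, hK, hKH, hHK⟩ := h.exists_inter_eq hH hE'
  have hKF : K = F := by
    by_contra hKF
    exact hKH (h.eq_of_ridge_subset F hF K hK H hH hKF hHF E hE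
      (hEE'.trans (hHK ▸ inter_subset_right)) hEH)
  rwa [← hFH, inter_comm, ← hKF, hHK]

theorem erase_mem_facets (h : IsFaceFamily 𝓕 V)
    (hedge : ∀ x ∈ V, ∀ y ∈ V, x ≠ y → {x, y} ∈ 𝓕) {a b c : α} (ha : a ∈ V) (hb : b ∈ V)
    (hc : c ∈ V) (hab : a ≠ b) (hac : a ≠ c) (hbc : b ≠ c)
    (huniq : ∀ Y ∈ facets 𝓕 V, ∀ Z ∈ facets 𝓕 V, c ∈ Y → a ∉ Y → c ∈ Z → a ∉ Z → Y = Z) :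
    V.erase a ∈ facets 𝓕 V := by
  have hsep : ∀ x ∈ V, c ≠ x → a ≠ x → ∃ H ∈ facets 𝓕 V, c ∈ H ∧ x ∈ H ∧ a ∉ H := by
    intro x hx hcx hax
    obtain ⟨H, hH, hsub, haH⟩ := h.exists_facet {c, x} (hedge c hc x hx hcx) V h.top_mem
      (by simp [insert_subset_iff, hc, hx]) a ha (by simp [hac, hax])
    exact ⟨H, hH, hsub (by simp), hsub (by simp), haH⟩
  obtain ⟨Y, hY, hcY, -, haY⟩ := hsep b hb hbc.symm hab
  suffices hYV : V.erase a ⊆ Y by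
    rwa [hYV.antisymm fun x hx => mem_erase.2 ⟨fun hxa => haY (hxa ▸ hx),
      subset_of_mem_facets hY hx⟩]
  intro x hx
  obtain ⟨hxa, hxV⟩ := mem_erase.1 hx
  rcases eq_or_ne c x with rfl | hcx
  · exact hcY
  · obtain ⟨Z, hZ, hcZ, hxZ, haZ⟩ := hsep x hxV hcx hxa.symm
    exact huniq Z hZ Y hY hcZ haZ hcY haY ▸ hxZ

end IsFaceFamily

/-- The facets `H` of `V` that do not meet the facet `F` in a facet of `F`. -/
def farFacets [DecidableEq α] (𝓕 : Set (Finset α)) (V F : Finset α) : Set (Finset α) :=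
  {H ∈ facets 𝓕 V | H ≠ F ∧ F ∩ H ∉ facets 𝓕 F}

theorem IsFaceFamily.encard_facets_add_encard_farFacets_add_one_le [DecidableEq α]
    (h : IsFaceFamily 𝓕 V) (hF : F ∈ facets 𝓕 V) :
    (facets 𝓕 F).encard + (farFacets 𝓕 V F).encard + 1 ≤ (facets 𝓕 V).encard := by
  set 𝓝 := {H ∈ facets 𝓕 V | H ≠ F ∧ F ∩ H ∈ facets 𝓕 F}
  have hnear : (facets 𝓕 F).encard ≤ 𝓝.encard := by
    refine (Set.encard_le_encard fun E hE => ?_).trans (Set.encard_image_le (F ∩ ·) 𝓝)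
    obtain ⟨H, hH, hHF, rfl⟩ := h.exists_inter_eq hF hE
    exact ⟨H, ⟨hH, hHF, hE⟩, rfl⟩
  have hdisj : Disjoint 𝓝 (farFacets 𝓕 V F) :=
    Set.disjoint_left.2 fun H hnear hfar => hfar.2.2 hnear.2.2
  have hnotMem : F ∉ 𝓝 ∪ farFacets 𝓕 V F := fun hmem => hmem.elim (·.2.1 rfl) (·.2.1 rfl)
  calc (facets 𝓕 F).encard + (farFacets 𝓕 V F).encard + 1
      ≤ 𝓝.encard + (farFacets 𝓕 V F).encard + 1 := by gcongr
    _ = (insert F (𝓝 ∪ farFacets 𝓕 V F)).encard := by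
        rw [Set.encard_insert_of_notMem hnotMem, Set.encard_union_eq hdisj]
    _ ≤ (facets 𝓕 V).encard := Set.encard_le_encard <|
        Set.insert_subset hF (Set.union_subset (Set.sep_subset _ _) (Set.sep_subset _ _))

theorem eq_or_eq_or_eq_of_encard_le_two {S : Set α} (hS : S.encard ≤ 2) {y z : α} (hx : x ∈ S)
    (hy : y ∈ S) (hz : z ∈ S) : x = y ∨ x = z ∨ y = z := by
  by_contra! hne
  obtain ⟨hfin, hle⟩ := Set.encard_le_coe_iff_finite_ncard_le (k := 2).1 hS
  have := (Set.two_lt_ncard_iff hfin).2 ⟨x, y, z, hx, hy, hz, hne⟩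
  omega

theorem exists_forall_eq_or_eq_of_encard_le_two {S : Set α} (hS : S.encard ≤ 2)
    (hx : x ∈ S) : ∃ y ∈ S, ∀ z ∈ S, z = x ∨ z = y := by
  by_cases hex : ∃ y ∈ S, y ≠ x
  · obtain ⟨y, hy, hyx⟩ := hex
    refine ⟨y, hy, fun z hz => ?_⟩
    have := eq_or_eq_or_eq_of_encard_le_two hS hx hy hz
    tauto
  · exact ⟨x, hx, fun z hz => Or.inl (by_contra fun hzx => hex ⟨z, hz, hzx⟩)⟩

end FaceFamilies

section PyramidPairs

open Finset

variable {α : Type*} [DecidableEq α] {𝓕 : Set (Finset α)} {V Q S T H : Finset α} {a b c : α}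

/-- The facets `insert a Q` and `insert b Q` of `V` are pyramids with common base `Q` and with
different apexes `a` and `b`. -/
structure AdjacentPyramids (𝓕 : Set (Finset α)) (V Q : Finset α) (a b : α) : Prop where
  left_mem : insert a Q ∈ facets 𝓕 V
  right_mem : insert b Q ∈ facets 𝓕 V
  base_mem_left : Q ∈ facets 𝓕 (insert a Q)
  base_mem_right : Q ∈ facets 𝓕 (insert b Q)
  ne : a ≠ b

/-- The facets `S` of `F` for which the other facet of `V` through `S` does not contain `b`. -/
def avoidingFacets (𝓕 : Set (Finset α)) (V F : Finset α) (b : α) : Set (Finset α) :=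
  {S ∈ facets 𝓕 F | ∀ H ∈ facets 𝓕 V, F ∩ H = S → b ∉ H}

namespace AdjacentPyramids

theorem symm (hp : AdjacentPyramids 𝓕 V Q a b) : AdjacentPyramids 𝓕 V Q b a :=
  ⟨hp.right_mem, hp.left_mem, hp.base_mem_right, hp.base_mem_left, hp.ne.symm⟩

theorem left_mem_vertices (hp : AdjacentPyramids 𝓕 V Q a b) : a ∈ V :=
  subset_of_mem_facets hp.left_mem (mem_insert_self a Q)

theorem left_notMem (hp : AdjacentPyramids 𝓕 V Q a b) : a ∉ Q := fun ha =>
  (ssubset_of_mem_facets hp.base_mem_left).ne (insert_eq_self.2 ha).symm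

theorem right_notMem_left (hp : AdjacentPyramids 𝓕 V Q a b) : b ∉ insert a Q := by
  simpa [hp.ne.symm] using hp.symm.left_notMem

theorem right_ne_left (hp : AdjacentPyramids 𝓕 V Q a b) : insert b Q ≠ insert a Q := fun h =>
  hp.right_notMem_left (h ▸ mem_insert_self b Q)

theorem inter_eq (hp : AdjacentPyramids 𝓕 V Q a b) : insert a Q ∩ insert b Q = Q := by
  rw [inter_insert_of_notMem hp.right_notMem_left, inter_eq_right.2 (subset_insert a Q)]

theorem inter_base (hp : AdjacentPyramids 𝓕 V Q a b) (hS : S ⊆ insert a Q) :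
    S ∩ Q = S.erase a := by
  rw [← erase_insert hp.left_notMem, inter_erase, inter_eq_left.2 hS]

theorem apex_mem_of_mem_facets (hp : AdjacentPyramids 𝓕 V Q a b) (hS : S ∈ facets 𝓕 (insert a Q))
    (hSQ : S ≠ Q) : a ∈ S := by
  by_contra ha
  exact hSQ (eq_of_mem_facets_of_mem_facets hS hp.base_mem_left
    ((subset_insert_iff_of_notMem ha).1 (subset_of_mem_facets hS)))

theorem eq_of_erase_subset (hp : AdjacentPyramids 𝓕 V Q a b) (hS : S ∈ facets 𝓕 (insert a Q))
    (hSQ : S ≠ Q) (hT : T ∈ facets 𝓕 (insert a Q)) (hTQ : T ≠ Q) (hST : S.erase a ⊆ T) : S = T := by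
  refine eq_of_mem_facets_of_mem_facets hS hT ?_
  rw [← insert_erase (hp.apex_mem_of_mem_facets hS hSQ)]
  exact insert_subset (hp.apex_mem_of_mem_facets hT hTQ) hST

theorem exists_erase_subset (h : IsFaceFamily 𝓕 V) (hp : AdjacentPyramids 𝓕 V Q a b)
    (hS : S ∈ facets 𝓕 (insert a Q)) (hSQ : S ≠ Q) :
    ∃ T ∈ facets 𝓕 (insert b Q), T ≠ Q ∧ S.erase a ⊆ T := by
  rw [← hp.inter_base (subset_of_mem_facets hS)]
  exact h.exists_facet_ne (mem_of_mem_facets hp.right_mem) hp.base_mem_right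
    (h.inter_mem S (mem_of_mem_facets hS) Q (mem_of_mem_facets hp.base_mem_left))
    (inter_subset_right.ssubset_of_ne fun hQ => hSQ
      (eq_of_mem_facets_of_mem_facets hp.base_mem_left hS (inter_eq_right.1 hQ)).symm)

theorem insert_erase_mem_facets (h : IsFaceFamily 𝓕 V) (hp : AdjacentPyramids 𝓕 V Q a b)
    (hS : S ∈ facets 𝓕 (insert a Q)) (hSQ : S ≠ Q) :
    insert b (S.erase a) ∈ facets 𝓕 (insert b Q) := by
  obtain ⟨T, hT, hTQ, hST⟩ := hp.exists_erase_subset h hS hSQ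
  obtain ⟨S', hS', hS'Q, hTS'⟩ := hp.symm.exists_erase_subset h hT hTQ
  have hTS : T.erase b ⊆ S.erase a := by
    rw [← hp.symm.inter_base (subset_of_mem_facets hT)] at hTS' ⊢
    rw [← hp.inter_base (subset_of_mem_facets hS)] at hST ⊢
    rw [hp.eq_of_erase_subset hS hSQ hS' hS'Q ((hp.inter_base (subset_of_mem_facets hS)) ▸
      (subset_inter hST inter_subset_right).trans hTS')]
    exact subset_inter hTS' inter_subset_right
  have hbT := hp.symm.apex_mem_of_mem_facets hT hTQ
  rwa [(insert_subset hbT hST).antisymm (by rw [← insert_erase hbT]; gcongr)]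

theorem mem_farFacets (h : IsFaceFamily 𝓕 V) (hp : AdjacentPyramids 𝓕 V Q a b)
    (hH : H ∈ facets 𝓕 V) (hcH : c ∈ H) (haH : a ∉ H) (hca : c ∉ insert a Q)
    (hcb : c ∉ insert b Q) : H ∈ farFacets 𝓕 V (insert a Q) := by
  have hHF : H ≠ insert a Q := fun hHF => hca (hHF ▸ hcH)
  refine ⟨hH, hHF, fun hmem => ?_⟩
  by_cases hHQ : insert a Q ∩ H = Q
  · exact hcb (h.eq_of_ridge_subset _ hp.left_mem _ hp.right_mem _ hH hp.right_ne_left hHF Q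
      hp.base_mem_left (subset_insert b Q) (hHQ ▸ inter_subset_right) ▸ hcH)
  · exact haH (mem_of_mem_inter_right (hp.apex_mem_of_mem_facets hmem hHQ))

theorem ne_base_of_mem_avoidingFacets (hp : AdjacentPyramids 𝓕 V Q a b)
    (hS : S ∈ avoidingFacets 𝓕 V (insert a Q) b) : S ≠ Q := fun hSQ =>
  hS.2 _ hp.right_mem (hSQ ▸ hp.inter_eq) (mem_insert_self b Q)

theorem exists_mem_farFacets_of_mem_avoidingFacets (h : IsFaceFamily 𝓕 V)
    (hp : AdjacentPyramids 𝓕 V Q a b) (hS : S ∈ avoidingFacets 𝓕 V (insert a Q) b) :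
    ∃ H ∈ farFacets 𝓕 V (insert a Q), H ∩ Q = S.erase a := by
  have hSQ := hp.ne_base_of_mem_avoidingFacets hS
  obtain ⟨H, hH, hHG, hGH⟩ := h.exists_inter_eq hp.right_mem
    (hp.insert_erase_mem_facets h hS.1 hSQ)
  have hbH : b ∈ H := mem_of_mem_inter_right (hGH ▸ mem_insert_self b (S.erase a))
  have hHQ : H ∩ Q = S.erase a := by
    have hsub : S.erase a ⊆ Q := hp.inter_base (subset_of_mem_facets hS.1) ▸ inter_subset_right
    calc H ∩ Q = insert b Q ∩ H ∩ Q := by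
          rw [inter_right_comm, inter_eq_right.2 (subset_insert b Q), inter_comm]
      _ = S.erase a := by
          rw [hGH, insert_inter_of_notMem hp.symm.left_notMem, inter_eq_left.2 hsub]
  refine ⟨H, ⟨hH, fun hHF => hp.right_notMem_left (hHF ▸ hbH), fun hmem => ?_⟩, hHQ⟩
  have hne : insert a Q ∩ H ≠ Q := fun hQ => hHG <| h.eq_of_ridge_subset _ hp.left_mem _ hH _
    hp.right_mem (fun hHF => hp.right_notMem_left (hHF ▸ hbH)) hp.right_ne_left Q
    hp.base_mem_left (hQ ▸ inter_subset_right) (subset_insert b Q)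
  refine hS.2 H hH (hp.eq_of_erase_subset hS.1 hSQ hmem hne ?_).symm hbH
  rw [← hHQ]
  exact subset_inter (inter_subset_right.trans (subset_insert a Q)) inter_subset_left

theorem encard_avoidingFacets_le (h : IsFaceFamily 𝓕 V) (hp : AdjacentPyramids 𝓕 V Q a b) :
    (avoidingFacets 𝓕 V (insert a Q) b).encard ≤ (farFacets 𝓕 V (insert a Q)).encard := by
  refine (Set.encard_le_encard fun S hS => ?_).trans
    (Set.encard_image_le (fun H => insert a (H ∩ Q)) _)
  obtain ⟨H, hH, hHQ⟩ := hp.exists_mem_farFacets_of_mem_avoidingFacets h hS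
  refine ⟨H, hH, ?_⟩
  simp only [hHQ]
  exact insert_erase (hp.apex_mem_of_mem_facets hS.1 (hp.ne_base_of_mem_avoidingFacets hS))

theorem notMem_of_mem_farFacets (h : IsFaceFamily 𝓕 V) (hp : AdjacentPyramids 𝓕 V Q a b)
    (hedge : ∀ x ∈ V, ∀ y ∈ V, x ≠ y → {x, y} ∈ 𝓕) (hcV : c ∈ V) (hca : c ∉ insert a Q)
    (hcb : c ∉ insert b Q) (hfar : (farFacets 𝓕 V (insert a Q)).encard ≤ 2)
    (herase : V.erase a ∉ facets 𝓕 V) (hH : H ∈ farFacets 𝓕 V (insert a Q)) : a ∉ H := by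
  intro haH
  refine herase (h.erase_mem_facets hedge hp.left_mem_vertices hp.symm.left_mem_vertices hcV hp.ne
    (fun hac => hca (hac ▸ mem_insert_self a Q)) (fun hbc => hcb (hbc ▸ mem_insert_self b Q)) ?_)
  intro Y hY Z hZ hcY haY hcZ haZ
  rcases eq_or_eq_or_eq_of_encard_le_two hfar hH (hp.mem_farFacets h hY hcY haY hca hcb)
    (hp.mem_farFacets h hZ hcZ haZ hca hcb) with rfl | rfl | rfl
  exacts [(haY haH).elim, (haZ haH).elim, rfl]

theorem avoidingFacets_nonempty (h : IsFaceFamily 𝓕 V) (hp : AdjacentPyramids 𝓕 V Q a b)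
    (hedge : ∀ x ∈ V, ∀ y ∈ V, x ≠ y → {x, y} ∈ 𝓕) (hcV : c ∈ V) (hca : c ∉ insert a Q)
    (hcb : c ∉ insert b Q) (hfar : (farFacets 𝓕 V (insert a Q)).encard ≤ 2)
    (herase : V.erase b ∉ facets 𝓕 V) : (avoidingFacets 𝓕 V (insert a Q) b).Nonempty := by
  by_contra! hempty
  have haV := hp.left_mem_vertices
  have hbV := hp.symm.left_mem_vertices
  have hac : a ≠ c := fun hac => hca (hac ▸ mem_insert_self a Q)
  have hbc : b ≠ c := fun hbc => hcb (hbc ▸ mem_insert_self b Q)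
  have hmem : ∀ H ∈ facets 𝓕 V, c ∈ H → b ∉ H → H ∈ farFacets 𝓕 V (insert a Q) := by
    intro H hH hcH hbH
    have hHF : H ≠ insert a Q := fun hHF => hca (hHF ▸ hcH)
    refine ⟨hH, hHF, fun hS => hempty.subset ⟨hS, fun K hK hFK hbK => ?_⟩⟩
    exact hbH (h.eq_of_ridge_subset _ hp.left_mem _ hK _ hH
      (fun hKF => hp.right_notMem_left (hKF ▸ hbK)) hHF _ hS (hFK ▸ inter_subset_right)
      inter_subset_right ▸ hbK)
  obtain ⟨Y, hY, hsub, haY⟩ := h.exists_facet {b, c} (hedge b hbV c hcV hbc) V h.top_mem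
    (by simp [insert_subset_iff, hbV, hcV]) a haV (by simp [hp.ne, hac])
  have hfarY := hp.mem_farFacets h hY (hsub (by simp)) haY hca hcb
  refine herase (h.erase_mem_facets hedge hbV haV hcV hp.ne.symm hbc hac ?_)
  intro Z hZ W hW hcZ hbZ hcW hbW
  have hbY : b ∈ Y := hsub (by simp)
  rcases eq_or_eq_or_eq_of_encard_le_two hfar hfarY (hmem Z hZ hcZ hbZ) (hmem W hW hcW hbW)
    with rfl | rfl | rfl
  exacts [(hbZ hbY).elim, (hbW hbY).elim, rfl]

end AdjacentPyramids

end PyramidPairs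

section FacetIncidence

open Finset

variable {α β : Type*} [DecidableEq α] [DecidableEq β] {N f : ℕ} {𝓕 𝓢 : Set (Finset α)}
  {V F Q S T : Finset α} {a b : α}

/-- The properties required of the vertex sets `𝓢` of the facets of a large facet, where `V` is the
set of vertices of the large facet, `N` its cardinality and `f` a lower bound for the number of
facets. Two facets `S₁` and `T` are adjacent if no third facet contains `S₁ ∩ T`. -/
structure LargeFacetIncidence (N f : ℕ) (V : Finset α) (𝓢 : Set (Finset α)) : Prop where
  card_eq : #V = N
  ssubset : ∀ S ∈ 𝓢, S ⊂ V
  antichain : ∀ S ∈ 𝓢, ∀ T ∈ 𝓢, S ⊆ T → S = T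
  le_encard : (f : ℕ∞) ≤ 𝓢.encard
  exists_adjacent : ∀ S₁ ∈ 𝓢, ∀ S₂ ∈ 𝓢, ∃ T ∈ 𝓢, T ≠ S₁ ∧ T ≠ S₂ ∧ #T + 2 = N ∧
    ∀ S ∈ 𝓢, S₁ ∩ T ⊆ S → S = S₁ ∨ S = T
  card_inter_le : ∀ S ∈ 𝓢, ∀ T ∈ 𝓢, S ≠ T → #S + 2 = N → #T + 2 = N → #(S ∩ T) + 4 ≤ N

namespace LargeFacetIncidence

theorem notMem (h : LargeFacetIncidence N f V 𝓢) (ha : a ∉ V) (hS : S ∈ 𝓢) : a ∉ S :=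
  fun haS => ha ((h.ssubset S hS).subset haS)

theorem injOn_insert (h : LargeFacetIncidence N f V 𝓢) (ha : a ∉ V) : Set.InjOn (insert a) 𝓢 :=
  fun S hS T hT hST => by
    rw [← erase_insert (h.notMem ha hS), hST, erase_insert (h.notMem ha hT)]

theorem exists_adjacent_pyramid (h : LargeFacetIncidence N f V 𝓢) (hne : 𝓢.Nonempty) (ha : a ∉ V) :
    ∀ S₁ ∈ insert V (insert a '' 𝓢), ∀ S₂ ∈ insert V (insert a '' 𝓢),
      ∃ T ∈ insert V (insert a '' 𝓢), T ≠ S₁ ∧ T ≠ S₂ ∧ #T + 2 = N + 1 ∧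
        ∀ S ∈ insert V (insert a '' 𝓢), S₁ ∩ T ⊆ S → S = S₁ ∨ S = T := by
  have hbase : ∀ S ∈ insert V (insert a '' 𝓢), ∃ R ∈ 𝓢, S = V ∨ S = insert a R := by
    rintro S (rfl | ⟨R, hR, rfl⟩)
    exacts [⟨_, hne.some_mem, Or.inl rfl⟩, ⟨R, hR, Or.inr rfl⟩]
  intro S₁ hS₁ S₂ hS₂
  obtain ⟨R₁, hR₁, hS₁R⟩ := hbase S₁ hS₁
  obtain ⟨R₂, hR₂, hS₂R⟩ := hbase S₂ hS₂
  obtain ⟨T, hT, hTR₁, hTR₂, hTc, hadj⟩ := h.exists_adjacent R₁ hR₁ R₂ hR₂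
  have haT := h.notMem ha hT
  have hne_of {R S} (hR : R ∈ 𝓢) (hTR : T ≠ R) (hS : S = V ∨ S = insert a R) : insert a T ≠ S := by
    rintro rfl
    rcases hS with hV | hR'
    · exact ha (hV ▸ mem_insert_self a T)
    · exact hTR (h.injOn_insert ha hT hR hR')
  refine ⟨insert a T, Or.inr ⟨T, hT, rfl⟩, hne_of hR₁ hTR₁ hS₁R, hne_of hR₂ hTR₂ hS₂R,
    by rw [card_insert_of_notMem haT]; omega, ?_⟩
  rintro _ (rfl | ⟨S, hS, rfl⟩) hsub
  · refine hS₁R.elim (fun h => Or.inl h.symm) ?_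
    rintro rfl
    exact (ha (hsub (by simp))).elim
  rcases hS₁R with rfl | rfl
  · rw [inter_insert_of_notMem ha, inter_eq_right.2 (h.ssubset T hT).subset,
      subset_insert_iff_of_notMem haT] at hsub
    exact Or.inr (congrArg (insert a) (h.antichain T hT S hS hsub).symm)
  · rw [← insert_inter_distrib, insert_subset_insert_iff (by simp [haT])] at hsub
    exact (hadj S hS hsub).imp (congrArg _) (congrArg _)

theorem card_inter_le_pyramid (h : LargeFacetIncidence N f V 𝓢) (ha : a ∉ V) :
    ∀ S ∈ insert V (insert a '' 𝓢), ∀ T ∈ insert V (insert a '' 𝓢), S ≠ T →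
      #S + 2 = N + 1 → #T + 2 = N + 1 → #(S ∩ T) + 4 ≤ N + 1 := by
  have hV := h.card_eq
  rintro _ (rfl | ⟨S, hS, rfl⟩) _ (rfl | ⟨T, hT, rfl⟩) hST hSc hTc
  any_goals omega
  rw [card_insert_of_notMem (h.notMem ha hS)] at hSc
  rw [card_insert_of_notMem (h.notMem ha hT)] at hTc
  have := h.card_inter_le S hS T hT (fun h => hST (h ▸ rfl)) (by omega) (by omega)
  rw [← insert_inter_distrib, card_insert_of_notMem (by simp [h.notMem ha hS])]
  omega

theorem pyramid (h : LargeFacetIncidence N f V 𝓢) (hne : 𝓢.Nonempty) (ha : a ∉ V) :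
    LargeFacetIncidence (N + 1) (f + 1) (insert a V) (insert V (insert a '' 𝓢)) where
  card_eq := by rw [card_insert_of_notMem ha, h.card_eq]
  ssubset := by
    rintro _ (rfl | ⟨S, hS, rfl⟩)
    · exact ssubset_insert ha
    · rw [ssubset_iff_subset_not_subset, insert_subset_insert_iff (h.notMem ha hS),
        insert_subset_insert_iff ha]
      exact h.ssubset S hS
  antichain := by
    rintro _ (rfl | ⟨S, hS, rfl⟩) _ (rfl | ⟨T, hT, rfl⟩) hST
    · rfl
    · exact ((h.ssubset T hT).not_subset ((subset_insert_iff_of_notMem ha).1 hST)).elim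
    · exact (ha (hST (mem_insert_self a S))).elim
    · rw [h.antichain S hS T hT ((insert_subset_insert_iff (h.notMem ha hS)).1 hST)]
  le_encard := by
    have hV : V ∉ insert a '' 𝓢 := by
      rintro ⟨S, -, hS⟩
      exact ha (hS ▸ mem_insert_self a S)
    rw [Set.encard_insert_of_notMem hV, (h.injOn_insert ha).encard_image]
    push_cast
    exact add_le_add_left h.le_encard 1
  exists_adjacent := h.exists_adjacent_pyramid hne ha
  card_inter_le := h.card_inter_le_pyramid ha

theorem map (h : LargeFacetIncidence N f V 𝓢) {φ : α → β} (hφ : Set.InjOn φ V) :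
    LargeFacetIncidence N f (V.image φ) (image φ '' 𝓢) := by
  have hsub {S} (hS : S ∈ 𝓢) : S ⊆ V := (h.ssubset S hS).subset
  have image_subset {S T} (hS : S ⊆ V) (hT : T ⊆ V) : S.image φ ⊆ T.image φ ↔ S ⊆ T :=
    image_subset_image_iff_of_injOn hφ hS hT
  have image_inj {S T} (hS : S ⊆ V) (hT : T ⊆ V) (hST : S.image φ = T.image φ) : S = T :=
    ((image_subset hS hT).1 hST.subset).antisymm ((image_subset hT hS).1 hST.symm.subset)
  have image_inter {S T} (hS : S ⊆ V) (hT : T ⊆ V) :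
      S.image φ ∩ T.image φ = (S ∩ T).image φ :=
    (image_inter_of_injOn S T (hφ.mono (Set.union_subset hS hT))).symm
  have card_image {S} (hS : S ⊆ V) : #(S.image φ) = #S := card_image_of_injOn (hφ.mono hS)
  refine ⟨?_, ?_, ?_, ?_, ?_, ?_⟩
  · rw [card_image subset_rfl, h.card_eq]
  · rintro _ ⟨S, hS, rfl⟩
    rw [ssubset_iff_subset_not_subset, image_subset (hsub hS) subset_rfl,
      image_subset subset_rfl (hsub hS)]
    exact h.ssubset S hS
  · rintro _ ⟨S, hS, rfl⟩ _ ⟨T, hT, rfl⟩ hST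
    rw [h.antichain S hS T hT ((image_subset (hsub hS) (hsub hT)).1 hST)]
  · rw [Set.InjOn.encard_image fun S hS T hT => image_inj (hsub hS) (hsub hT)]
    exact h.le_encard
  · rintro _ ⟨S₁, hS₁, rfl⟩ _ ⟨S₂, hS₂, rfl⟩
    obtain ⟨T, hT, hTS₁, hTS₂, hTc, hadj⟩ := h.exists_adjacent S₁ hS₁ S₂ hS₂
    refine ⟨_, ⟨T, hT, rfl⟩, mt (image_inj (hsub hT) (hsub hS₁)) hTS₁,
      mt (image_inj (hsub hT) (hsub hS₂)) hTS₂, by rw [card_image (hsub hT), hTc], ?_⟩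
    rintro _ ⟨S, hS, rfl⟩ hinter
    rw [image_inter (hsub hS₁) (hsub hT),
      image_subset (inter_subset_left.trans (hsub hS₁)) (hsub hS)] at hinter
    exact (hadj S hS hinter).imp (congrArg _) (congrArg _)
  · rintro _ ⟨S, hS, rfl⟩ _ ⟨T, hT, rfl⟩ hST
    rw [image_inter (hsub hS) (hsub hT), card_image (hsub hS), card_image (hsub hT),
      card_image (inter_subset_left.trans (hsub hS))]
    exact h.card_inter_le S hS T hT fun h => hST (h ▸ rfl)

end LargeFacetIncidence

theorem exists_adjacentPyramids (h : IsFaceFamily 𝓕 V) (hF : F ∈ facets 𝓕 V) (hQ : Q ∈ facets 𝓕 F)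
    (hFc : #F = N) (hQc : #Q + 1 = N) (hcard : ∀ G ∈ facets 𝓕 V, N ≤ #G → #G = N) :
    ∃ a b, AdjacentPyramids 𝓕 V Q a b ∧ insert a Q = F := by
  obtain ⟨G, hG, hGF, hFG⟩ := h.exists_inter_eq hF hQ
  have hQG : Q ⊆ G := hFG ▸ inter_subset_right
  have hQG' := h.mem_facets_of_subset hF hG hGF hQ hQG
  have hGc := hcard G hG (by have := card_lt_card (ssubset_of_mem_facets hQG'); omega)
  obtain ⟨a, -, rfl⟩ := exists_eq_insert_iff.2 ⟨subset_of_mem_facets hQ, hQc.trans hFc.symm⟩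
  obtain ⟨b, -, rfl⟩ := exists_eq_insert_iff.2 ⟨hQG, hQc.trans hGc.symm⟩
  exact ⟨a, b, ⟨hF, hG, hQ, hQG', fun hab => hGF (hab ▸ rfl)⟩, rfl⟩

end FacetIncidence

section ErasedVertex

open Finset

variable {α : Type*} [DecidableEq α] {N f : ℕ} {𝓕 : Set (Finset α)} {V F W Q T : Finset α}
  {a b c : α}

theorem IsFaceFamily.exists_mem_facets_of_adjacent (h : IsFaceFamily 𝓕 V) (hF : F ∈ facets 𝓕 V)
    (hW : W ∈ facets 𝓕 V) (hWF : W ≠ F) (hS : F ∩ W ∈ facets 𝓕 F) (hT : T ∈ facets 𝓕 F)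
    (hTS : T ≠ F ∩ W) (hadj : ∀ S ∈ facets 𝓕 F, F ∩ W ∩ T ⊆ S → S = F ∩ W ∨ S = T)
    (hfar : ∀ H ∈ farFacets 𝓕 V F, ¬ F ∩ W ∩ T ⊆ H) :
    ∃ X ∈ facets 𝓕 V, F ∩ X = T ∧ ∃ z ∈ W ∩ X, z ∉ F := by
  have hSW := h.mem_facets_of_subset hF hW hWF hS inter_subset_right
  obtain ⟨E, hE, hES, hDE⟩ := h.exists_facet_ne (A := F ∩ W ∩ T) (mem_of_mem_facets hW) hSW
    (h.inter_mem _ (mem_of_mem_facets hS) T (mem_of_mem_facets hT))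
    (inter_subset_left.ssubset_of_ne fun hD =>
      hTS (eq_of_mem_facets_of_mem_facets hS hT (inter_eq_left.1 hD)).symm)
  obtain ⟨X, hX, hXW, hWX⟩ := h.exists_inter_eq hW hE
  have hDX : F ∩ W ∩ T ⊆ X := hDE.trans (hWX ▸ inter_subset_right)
  have hXF : X ≠ F := fun hXF => hES (by rw [← hWX, hXF, inter_comm])
  have hFX : F ∩ X ∈ facets 𝓕 F := by_contra fun hmem => hfar X ⟨hX, hXF, hmem⟩ hDX
  have hXT : F ∩ X = T := by
    refine (hadj _ hFX (subset_inter (inter_subset_left.trans inter_subset_left)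
      hDX)).resolve_left fun hXS => hXW ?_
    exact h.eq_of_ridge_subset F hF X hX W hW hXF hWF _ hS (hXS ▸ inter_subset_right)
      inter_subset_right
  obtain ⟨z, hzE, hzS⟩ : ∃ z ∈ E, z ∉ F ∩ W :=
    not_subset.1 fun hsub => hES (eq_of_mem_facets_of_mem_facets hE hSW hsub)
  rw [← hWX] at hzE
  exact ⟨X, hX, hXT, z, hzE, fun hzF => hzS (mem_inter.2 ⟨hzF, mem_of_mem_inter_left hzE⟩)⟩

theorem AdjacentPyramids.not_exists_facet_through (h : IsFaceFamily 𝓕 V)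
    (hp : AdjacentPyramids 𝓕 V Q a b)
    (hinc : ∀ H ∈ facets 𝓕 V, N ≤ #H → LargeFacetIncidence N f H (facets 𝓕 H))
    (hT : T ∈ facets 𝓕 (insert a Q)) (hTc : #T + 2 = N) (hTQ : T ≠ Q) :
    ¬ ∃ X ∈ facets 𝓕 V, insert a Q ∩ X = T ∧ b ∈ X ∧ ∃ z ∈ X, z ∉ insert a Q ∧ z ≠ b := by
  rintro ⟨X, hX, hXT, hbX, z, hzX, hzF, hzb⟩
  have hTX : T ⊆ X := hXT ▸ inter_subset_right
  have haT := hp.apex_mem_of_mem_facets hT hTQ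
  have hbT : b ∉ T := fun hbT => hp.right_notMem_left (subset_of_mem_facets hT hbT)
  have hXc : N ≤ #X := by
    have hsub := card_le_card (insert_subset hzX (insert_subset hbX hTX))
    rw [card_insert_of_notMem, card_insert_of_notMem hbT] at hsub
    · omega
    · simpa [hzb] using fun hzT => hzF (subset_of_mem_facets hT hzT)
  have hX₁ : T ∈ facets 𝓕 X := h.mem_facets_of_subset hp.left_mem hX
    (fun hXF => hp.right_notMem_left (hXF ▸ hbX)) hT hTX
  have hX₂ : insert b (T.erase a) ∈ facets 𝓕 X := h.mem_facets_of_subset hp.right_mem hX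
    (fun hXG => hp.symm.right_notMem_left (hXG ▸ hTX haT)) (hp.insert_erase_mem_facets h hT hTQ)
    (insert_subset hbX ((erase_subset a T).trans hTX))
  have hcard := card_erase_add_one haT
  have hle := (hinc X hX hXc).card_inter_le T hX₁ _ hX₂
    (fun hT => hbT (hT ▸ mem_insert_self b _)) hTc (by
      rw [card_insert_of_notMem fun hb => hbT (mem_of_mem_erase hb)]
      omega)
  rw [inter_insert_of_notMem hbT, inter_eq_right.2 (erase_subset a T)] at hle
  omega

theorem AdjacentPyramids.erase_mem_facets (h : IsFaceFamily 𝓕 V)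
    (hp : AdjacentPyramids 𝓕 V Q a b) (hedge : ∀ x ∈ V, ∀ y ∈ V, x ≠ y → {x, y} ∈ 𝓕)
    (hcV : c ∈ V) (hca : c ∉ insert a Q) (hcb : c ∉ insert b Q)
    (hfar : (farFacets 𝓕 V (insert a Q)).encard ≤ 2) (hQc : #Q + 1 = N)
    (hinc : ∀ H ∈ facets 𝓕 V, N ≤ #H → LargeFacetIncidence N f H (facets 𝓕 H)) :
    V.erase a ∈ facets 𝓕 V ∨ V.erase b ∈ facets 𝓕 V := by
  by_contra! herase
  have hfar_a := fun H => hp.notMem_of_mem_farFacets (H := H) h hedge hcV hca hcb hfar herase.1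
  obtain ⟨S₁, hS₁⟩ := hp.avoidingFacets_nonempty h hedge hcV hca hcb hfar herase.2
  obtain ⟨S₂, hS₂, havoid⟩ := exists_forall_eq_or_eq_of_encard_le_two
    ((hp.encard_avoidingFacets_le h).trans hfar) hS₁
  have hFc : N ≤ #(insert a Q) := (card_insert_of_notMem hp.left_notMem).symm ▸ hQc.symm.le
  obtain ⟨T, hT, hTS₁, hTS₂, hTc, hadj⟩ := (hinc _ hp.left_mem hFc).exists_adjacent S₁ hS₁.1 S₂
    hS₂.1
  have hTQ : T ≠ Q := by
    rintro rfl
    omega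
  obtain ⟨K, hK, hFK, hbK⟩ : ∃ K ∈ facets 𝓕 V, insert a Q ∩ K = T ∧ b ∈ K := by
    by_contra! hT'
    exact (havoid T ⟨hT, hT'⟩).elim hTS₁ hTS₂
  obtain ⟨W, hW, hWF, rfl⟩ := h.exists_inter_eq hp.left_mem hS₁.1
  have haW := hp.apex_mem_of_mem_facets hS₁.1 (hp.ne_base_of_mem_avoidingFacets hS₁)
  obtain ⟨X, hX, hFX, z, hz, hzF⟩ := h.exists_mem_facets_of_adjacent hp.left_mem hW hWF hS₁.1 hT
    hTS₁ hadj fun H hH hsub => hfar_a H hH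
      (hsub (mem_inter.2 ⟨haW, hp.apex_mem_of_mem_facets hT hTQ⟩))
  obtain ⟨hzW, hzX⟩ := mem_inter.1 hz
  have hKX : K = X := h.eq_of_ridge_subset _ hp.left_mem K hK X hX
    (fun hKF => hp.right_notMem_left (hKF ▸ hbK)) (fun hXF => hzF (hXF ▸ hzX)) T hT
    (hFK ▸ inter_subset_right) (hFX ▸ inter_subset_right)
  exact hp.not_exists_facet_through h hinc hT hTc hTQ
    ⟨X, hX, hFX, hKX ▸ hbK, z, hzX, hzF, fun hzb => hS₁.2 W hW rfl (hzb ▸ hzW)⟩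

theorem exists_erase_mem_facets (h : IsFaceFamily 𝓕 V)
    (hedge : ∀ x ∈ V, ∀ y ∈ V, x ≠ y → {x, y} ∈ 𝓕) (hcard : (facets 𝓕 V).encard ≤ f + 3)
    (hinc : ∀ H ∈ facets 𝓕 V, N ≤ #H → LargeFacetIncidence N f H (facets 𝓕 H))
    (hF : F ∈ facets 𝓕 V) (hFc : N ≤ #F) (hQ : Q ∈ facets 𝓕 F) (hQc : #Q + 1 = N) :
    ∃ a ∈ V, V.erase a ∈ facets 𝓕 V := by
  have hFinc := hinc F hF hFc
  obtain ⟨a, b, hp, rfl⟩ := exists_adjacentPyramids h hF hQ hFinc.card_eq hQc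
    fun G hG hGc => (hinc G hG hGc).card_eq
  have hfar : (farFacets 𝓕 V (insert a Q)).encard ≤ 2 := by
    have hle : (f : ℕ∞) + (farFacets 𝓕 V (insert a Q)).encard + 1 ≤ f + 2 + 1 := by
      calc _ ≤ (facets 𝓕 (insert a Q)).encard + (farFacets 𝓕 V (insert a Q)).encard + 1 := by
            gcongr
            exact hFinc.le_encard
        _ ≤ (facets 𝓕 V).encard := h.encard_facets_add_encard_farFacets_add_one_le hF
        _ ≤ f + 2 + 1 := hcard.trans_eq (by rw [add_assoc]; rfl)
    rwa [ENat.add_le_add_iff_right ENat.one_ne_top,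
      ENat.add_le_add_iff_left (ENat.natCast_ne_top f)] at hle
  by_cases hc : ∃ c ∈ V, c ∉ insert a Q ∧ c ≠ b
  · obtain ⟨c, hcV, hca, hcb⟩ := hc
    have hcG : c ∉ insert b Q := by simpa [hcb] using fun hcQ => hca (mem_insert_of_mem hcQ)
    exact (hp.erase_mem_facets h hedge hcV hca hcG hfar hQc hinc).elim
      (fun ha => ⟨a, hp.left_mem_vertices, ha⟩) fun hb => ⟨b, hp.symm.left_mem_vertices, hb⟩
  · push Not at hc
    refine ⟨b, hp.symm.left_mem_vertices, ?_⟩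
    suffices V.erase b = insert a Q from this ▸ hF
    refine Subset.antisymm (fun x hx => by_contra fun hxF => ?_)
      (subset_erase.2 ⟨subset_of_mem_facets hF, hp.right_notMem_left⟩)
    exact ne_of_mem_erase hx (hc x (mem_of_mem_erase hx) hxF)

end ErasedVertex

section FaceLattices

variable {m n : ℕ} {P X Y H : Set (EuclideanSpace ℝ (Fin n))} {P' : Set (EuclideanSpace ℝ (Fin m))}

instance faceLatticeBoundedOrder (P : Set (EuclideanSpace ℝ (Fin n))) :
    BoundedOrder (FaceLattice P) where
  bot := ⟨∅, isExposed_empty⟩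
  bot_le X := Set.empty_subset X.1
  top := ⟨P, IsExposed.refl P⟩
  le_top X := X.2.subset

open Classical in
/-- The vertices of `X` as a finset, with junk value `∅` if there are infinitely many of them. -/
noncomputable def vertexFinset (X : Set (EuclideanSpace ℝ (Fin n))) :
    Finset (EuclideanSpace ℝ (Fin n)) :=
  if h : (vertexSet X).Finite then h.toFinset else ∅

/-- The vertex sets of the faces of `P`. -/
noncomputable def faceFamily (P : Set (EuclideanSpace ℝ (Fin n))) :
    Set (Finset (EuclideanSpace ℝ (Fin n))) :=
  Set.range fun X : FaceLattice P => vertexFinset X.1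

/-- The vertex sets of the maximal proper faces of `P`. For a point these are not its (nonexistent)
facets: the empty face is the only coatom. -/
noncomputable def facetFamily (P : Set (EuclideanSpace ℝ (Fin n))) :
    Set (Finset (EuclideanSpace ℝ (Fin n))) :=
  (fun X : FaceLattice P => vertexFinset X.1) '' {X | IsCoatom X}

namespace IsPolytope

theorem coe_vertexFinset (hP : IsPolytope P) (hX : IsExposed ℝ P X) :
    (vertexFinset X : Set (EuclideanSpace ℝ (Fin n))) = vertexSet X := by
  rw [vertexFinset, dif_pos (hP.finite_vertexSet_face hX), Set.Finite.coe_toFinset]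

theorem mem_vertexFinset (hP : IsPolytope P) (hX : IsExposed ℝ P X)
    {x : EuclideanSpace ℝ (Fin n)} : x ∈ vertexFinset X ↔ x ∈ X ∧ x ∈ vertexSet P := by
  rw [← Finset.mem_coe, hP.coe_vertexFinset hX, vertexSet_eq_inter hX, Set.mem_inter_iff]

theorem vertexFinset_subset_iff (hP : IsPolytope P) (hX : IsExposed ℝ P X)
    (hY : IsExposed ℝ P Y) : vertexFinset X ⊆ vertexFinset Y ↔ X ⊆ Y := by
  rw [← Finset.coe_subset, hP.coe_vertexFinset hX, hP.coe_vertexFinset hY, hP.subset_iff hX hY]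

theorem vertexFinset_ssubset_iff (hP : IsPolytope P) (hX : IsExposed ℝ P X)
    (hY : IsExposed ℝ P Y) : vertexFinset X ⊂ vertexFinset Y ↔ X ⊂ Y := by
  rw [ssubset_iff_subset_not_subset, ssubset_iff_subset_not_subset,
    hP.vertexFinset_subset_iff hX hY, hP.vertexFinset_subset_iff hY hX]

theorem vertexFinset_inter (hP : IsPolytope P) (hX : IsExposed ℝ P X) (hY : IsExposed ℝ P Y) :
    vertexFinset (X ∩ Y) = vertexFinset X ∩ vertexFinset Y := by
  ext x
  rw [Finset.mem_inter, hP.mem_vertexFinset (hX.inter hY), hP.mem_vertexFinset hX,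
    hP.mem_vertexFinset hY, Set.mem_inter_iff]
  tauto

theorem isCoatom_iff_mem_facetSet (hP : IsPolytope P) (hd : 1 ≤ affDim P) (X : FaceLattice P) :
    IsCoatom X ↔ X.1 ∈ facetSet P := by
  constructor
  · intro hX
    obtain ⟨x, hxP, hxX⟩ := Set.exists_of_ssubset (Subtype.coe_lt_coe.2 hX.lt_top)
    obtain ⟨H, hH, hXH, -⟩ := hP.exists_mem_facetSet hd X.2 hxP hxX
    have hHX : (⟨H, hH.1⟩ : FaceLattice P) = X := (hX.le_iff_eq fun h =>
      ne_of_mem_facetSet hH (congrArg Subtype.val h)).1 hXH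
    exact hHX ▸ hH
  · intro hX
    refine isCoatom_iff_ge_of_le.2 ⟨fun h => ne_of_mem_facetSet hX (congrArg Subtype.val h),
      fun Y hY hXY => (eq_of_mem_facetSet_of_subset hX Y.2 (fun h => hY (Subtype.ext h))
        hXY).symm.subset⟩

theorem facetFamily_eq_image_facetSet (hP : IsPolytope P) (hd : 1 ≤ affDim P) :
    facetFamily P = vertexFinset '' facetSet P := by
  ext E
  constructor
  · rintro ⟨X, hX, rfl⟩
    exact ⟨X, (hP.isCoatom_iff_mem_facetSet hd X).1 hX, rfl⟩
  · rintro ⟨X, hX, rfl⟩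
    exact ⟨⟨X, hX.1⟩, (hP.isCoatom_iff_mem_facetSet hd _).2 hX, rfl⟩

theorem exists_isCoatom_ge (hP : IsPolytope P) (A : FaceLattice P)
    {x : EuclideanSpace ℝ (Fin n)} (hxP : x ∈ P) (hxA : x ∉ A.1) :
    ∃ H : FaceLattice P, IsCoatom H ∧ A ≤ H ∧ x ∉ H.1 := by
  rcases Nat.eq_zero_or_pos (affDim P) with hd | hd
  · have hbot : ∀ Y : FaceLattice P, Y ≠ ⊤ → Y = ⊥ := fun Y hY =>
      Subtype.ext <| Set.not_nonempty_iff_eq_empty.1 fun hne =>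
        (affDim_lt_of_isExposed Y.2 hne fun h => hY (Subtype.ext h)).not_ge (by omega)
    have hA : A ≠ ⊤ := fun h => hxA (h ▸ hxP)
    refine ⟨A, ⟨hA, fun Y hAY => ?_⟩, le_rfl, hxA⟩
    by_contra hY
    exact not_lt_bot (hbot Y hY ▸ hAY)
  · obtain ⟨H, hH, hAH, hxH⟩ := hP.exists_mem_facetSet hd A.2 hxP hxA
    exact ⟨⟨H, hH.1⟩, (hP.isCoatom_iff_mem_facetSet hd _).2 hH, hAH, hxH⟩

theorem facets_faceFamily (hP : IsPolytope P) (hH : IsExposed ℝ P H) :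
    facets (faceFamily P) (vertexFinset H) = facetFamily H := by
  ext E
  constructor
  · rintro ⟨⟨⟨X, rfl⟩, hXH⟩, hmax⟩
    rw [hP.vertexFinset_ssubset_iff X.2 hH] at hXH
    refine ⟨⟨X, X.2.mono hH.subset hXH.subset⟩, isCoatom_iff_ge_of_le.2
      ⟨fun h => hXH.ne (congrArg Subtype.val h), fun Y hY hXY => ?_⟩, rfl⟩
    have hYP := hP.isExposed_trans hH Y.2
    have hYH : Y.1 ⊂ H := Y.2.subset.ssubset_of_ne fun h => hY (Subtype.ext h)
    exact (hP.vertexFinset_subset_iff hYP X.2).1 (hmax ⟨⟨⟨Y, hYP⟩, rfl⟩,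
      (hP.vertexFinset_ssubset_iff hYP hH).2 hYH⟩ ((hP.vertexFinset_subset_iff X.2 hYP).2 hXY))
  · rintro ⟨X, hX, rfl⟩
    have hXP := hP.isExposed_trans hH X.2
    refine ⟨⟨⟨⟨X, hXP⟩, rfl⟩, (hP.vertexFinset_ssubset_iff hXP hH).2 hX.lt_top⟩, ?_⟩
    rintro _ ⟨⟨Y, rfl⟩, hYH⟩ hXY
    rw [hP.vertexFinset_ssubset_iff Y.2 hH] at hYH
    refine (hP.vertexFinset_subset_iff Y.2 hXP).2
      ((isCoatom_iff_ge_of_le.1 hX).2 ⟨Y, Y.2.mono hH.subset hYH.subset⟩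
        (fun h => hYH.ne (congrArg Subtype.val h)) ?_)
    exact (hP.vertexFinset_subset_iff hXP Y.2).1 hXY

theorem isFaceFamily (hP : IsPolytope P) (hd : 2 ≤ affDim P) :
    IsFaceFamily (faceFamily P) (vertexFinset P) where
  top_mem := ⟨⊤, rfl⟩
  inter_mem := by
    rintro _ ⟨X, rfl⟩ _ ⟨Y, rfl⟩
    exact ⟨⟨X ∩ Y, X.2.inter Y.2⟩, hP.vertexFinset_inter X.2 Y.2⟩
  exists_facet := by
    rintro _ ⟨A, rfl⟩ _ ⟨H, rfl⟩ hAH x hxH hxA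
    rw [hP.vertexFinset_subset_iff A.2 H.2] at hAH
    rw [hP.mem_vertexFinset H.2] at hxH
    rw [hP.mem_vertexFinset A.2] at hxA
    obtain ⟨E, hE, hAE, hxE⟩ := (hP.face H.2 ⟨x, hxH.1⟩).exists_isCoatom_ge
      ⟨A, A.2.mono H.2.subset hAH⟩ hxH.1 fun h => hxA ⟨h, hxH.2⟩
    have hEP := hP.isExposed_trans H.2 E.2
    rw [hP.facets_faceFamily H.2]
    refine ⟨_, ⟨E, hE, rfl⟩, (hP.vertexFinset_subset_iff A.2 hEP).2 hAE, fun hx => hxE ?_⟩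
    exact ((hP.mem_vertexFinset hEP).1 hx).1
  eq_of_ridge_subset := by
    rw [hP.facets_faceFamily (IsExposed.refl P), hP.facetFamily_eq_image_facetSet (by omega)]
    rintro _ ⟨F, hF, rfl⟩ _ ⟨G, hG, rfl⟩ _ ⟨H, hH, rfl⟩ hGF hHF E hE hEG hEH
    have hFdim := hF.2.2
    rw [hP.facets_faceFamily hF.1,
      (hP.face hF.1 hF.2.1).facetFamily_eq_image_facetSet (by omega)] at hE
    obtain ⟨E, hE, rfl⟩ := hE
    have hEP := hP.isExposed_trans hF.1 hE.1
    rw [hP.vertexFinset_subset_iff hEP hG.1] at hEG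
    rw [hP.vertexFinset_subset_iff hEP hH.1] at hEH
    rw [eq_of_mem_facetSet_of_ridge_subset hF hG hH (fun h => hGF (h ▸ rfl))
      (fun h => hHF (h ▸ rfl)) hE hEG hEH]

theorem isAtom_singleton (hP : IsPolytope P) {v : EuclideanSpace ℝ (Fin n)}
    (hv : v ∈ vertexSet P) : IsAtom (⟨{v}, hP.isExposed_singleton hv⟩ : FaceLattice P) :=
  ⟨fun h => Set.singleton_ne_empty v (congrArg Subtype.val h), fun _ hY =>
    Subtype.ext (Set.ssubset_singleton_iff.1 hY)⟩

theorem exists_eq_singleton_of_isAtom (hP : IsPolytope P) {X : FaceLattice P} (hX : IsAtom X) :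
    ∃ v ∈ vertexSet P, X.1 = {v} := by
  have hne : X.1.Nonempty := Set.nonempty_iff_ne_empty.2 fun h => hX.1 (Subtype.ext h)
  obtain ⟨v, hv⟩ := (X.2.isCompact hP.isCompact).extremePoints_nonempty hne
  have hvX : v ∈ X.1 ∩ vertexSet P := vertexSet_eq_inter X.2 ▸ hv
  have hle := (hX.le_iff_eq (hP.isAtom_singleton hvX.2).1).1 (Set.singleton_subset_iff.2 hvX.1)
  exact ⟨v, hvX.2, congrArg Subtype.val hle.symm⟩

theorem exists_vertex_map (hP : IsPolytope P) (hP' : IsPolytope P')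
    (φ : FaceLattice P ≃o FaceLattice P') :
    ∃ f : EuclideanSpace ℝ (Fin n) → EuclideanSpace ℝ (Fin m), Set.InjOn f (vertexSet P) ∧
      ∀ X, vertexSet (φ X).1 = f '' vertexSet X.1 := by
  have hvertex : ∀ v, ∃ w, ∀ hv : v ∈ vertexSet P,
      w ∈ vertexSet P' ∧ (φ ⟨{v}, hP.isExposed_singleton hv⟩).1 = {w} := fun v => by
    by_cases hv : v ∈ vertexSet P
    · obtain ⟨w, hw, hφ⟩ := hP'.exists_eq_singleton_of_isAtom
        ((φ.isAtom_iff _).2 (hP.isAtom_singleton hv))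
      exact ⟨w, fun _ => ⟨hw, hφ⟩⟩
    · exact ⟨0, fun h => (hv h).elim⟩
  choose f hf using hvertex
  have mem_iff {v} (hv : v ∈ vertexSet P) (X : FaceLattice P) : f v ∈ (φ X).1 ↔ v ∈ X.1 := by
    rw [← Set.singleton_subset_iff, ← (hf v hv).2, ← Set.singleton_subset_iff (s := X.1)]
    exact φ.le_iff_le (x := ⟨{v}, _⟩)
  refine ⟨f, fun v hv w hw hvw => ?_, fun X => ?_⟩
  · exact (mem_iff hv ⟨{w}, hP.isExposed_singleton hw⟩).1 (by simp [(hf w hw).2, hvw])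
  rw [vertexSet_eq_inter (φ X).2, vertexSet_eq_inter X.2]
  ext w
  constructor
  · rintro ⟨hwX, hw⟩
    obtain ⟨v, hv, hvw⟩ := hP.exists_eq_singleton_of_isAtom
      ((φ.symm.isAtom_iff _).2 (hP'.isAtom_singleton hw))
    have hfv : f v = w := by
      have := (hf v hv).2
      simpa [← hvw] using this.symm
    exact ⟨v, ⟨(mem_iff hv X).1 (hfv ▸ hwX), hv⟩, hfv⟩
  · rintro ⟨v, ⟨hvX, hv⟩, rfl⟩
    exact ⟨(mem_iff hv X).2 hvX, (hf v hv).1⟩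

end IsPolytope

theorem CombEquiv.exists_image_facetFamily (h : CombEquiv P P') (hP : IsPolytope P)
    (hP' : IsPolytope P') : ∃ f : EuclideanSpace ℝ (Fin n) → EuclideanSpace ℝ (Fin m),
      Set.InjOn f (vertexFinset P) ∧ vertexFinset P' = (vertexFinset P).image f ∧
        facetFamily P' = Finset.image f '' facetFamily P := by
  obtain ⟨φ⟩ := h
  obtain ⟨f, hf, hvertex⟩ := hP.exists_vertex_map hP' φ
  have image_eq (X : FaceLattice P) : vertexFinset (φ X).1 = (vertexFinset X.1).image f := by
    rw [← Finset.coe_inj, Finset.coe_image, hP'.coe_vertexFinset (φ X).2, hP.coe_vertexFinset X.2,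
      hvertex]
  refine ⟨f, by rwa [hP.coe_vertexFinset (IsExposed.refl P)], ?_, ?_⟩
  · have htop := image_eq ⊤
    rwa [map_top] at htop
  · simp only [facetFamily, Set.image_image, ← image_eq]
    ext E
    constructor
    · rintro ⟨Y, hY, rfl⟩
      exact ⟨φ.symm Y, (φ.symm.isCoatom_iff Y).2 hY, by simp⟩
    · rintro ⟨X, hX, rfl⟩
      exact ⟨φ X, (φ.isCoatom_iff X).2 hX, rfl⟩

end FaceLattices

section Pyramids

variable {n : ℕ} {B X : Set (EuclideanSpace ℝ (Fin n))} {a : EuclideanSpace ℝ (Fin n)}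

theorem exists_forall_eq_and_lt_of_notMem_affineSpan (hB : B.Nonempty) (ha : a ∉ affineSpan ℝ B) :
    ∃ (g : StrongDual ℝ (EuclideanSpace ℝ (Fin n))) (c : ℝ), (∀ y ∈ B, g y = c) ∧ c < g a := by
  obtain ⟨x, hx⟩ := hB
  have hspan : ¬ vectorSpan ℝ (insert a B) ≤ vectorSpan ℝ B := fun h => ha <| by
    have hax : a -ᵥ x ∈ (affineSpan ℝ B).direction := direction_affineSpan ℝ B ▸
      h (vsub_mem_vectorSpan ℝ (Set.mem_insert a B) (Set.mem_insert_of_mem a hx))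
    simpa using AffineSubspace.vadd_mem_of_mem_direction hax (subset_affineSpan ℝ B hx)
  obtain ⟨g, hg, y, rfl | hy, hlt⟩ := exists_forall_eq_and_lt_of_not_vectorSpan_le hx hspan
  · exact ⟨g, g x, hg, hlt⟩
  · exact absurd (hg y hy) hlt.ne'

namespace IsPolytope

theorem convexHull_insert_vertexSet (hB : IsPolytope B) (a : EuclideanSpace ℝ (Fin n)) :
    convexHull ℝ (insert a (vertexSet B)) = convexHull ℝ (insert a B) := by
  refine (convexHull_mono (Set.insert_subset_insert extremePoints_subset)).antisymm
    (convexHull_min (Set.insert_subset (subset_convexHull ℝ _ (Set.mem_insert _ _)) ?_)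
      (convex_convexHull ℝ _))
  conv_lhs => rw [hB.eq_convexHull]
  exact convexHull_mono (Set.subset_insert _ _)

theorem pyramid (hB : IsPolytope B) (a : EuclideanSpace ℝ (Fin n)) :
    IsPolytope (convexHull ℝ (insert a B)) :=
  ⟨_, hB.finite_vertexSet.insert a, Set.insert_nonempty _ _,
    (hB.convexHull_insert_vertexSet a).symm⟩

theorem vertexSet_pyramid_subset (hB : IsPolytope B) (a : EuclideanSpace ℝ (Fin n)) :
    vertexSet (convexHull ℝ (insert a B)) ⊆ insert a (vertexSet B) :=
  hB.convexHull_insert_vertexSet a ▸ extremePoints_convexHull_subset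

theorem exists_isExposed_pyramid_inter_eq (hB : IsPolytope B) (ha : a ∉ affineSpan ℝ B)
    (hX : IsExposed ℝ B X) :
    ∃ Y, IsExposed ℝ (convexHull ℝ (insert a B)) Y ∧ a ∈ Y ∧ Y ∩ B = X := by
  obtain ⟨g, c, hg, hga⟩ := exists_forall_eq_and_lt_of_notMem_affineSpan hB.nonempty ha
  obtain ⟨l, d, hl, mem_X⟩ : ∃ (l : StrongDual ℝ (EuclideanSpace ℝ (Fin n))) (d : ℝ),
      (∀ y ∈ B, l y ≤ d) ∧ ∀ y, y ∈ X ↔ y ∈ B ∧ l y = d := by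
    rcases X.eq_empty_or_nonempty with rfl | hne
    · exact ⟨0, 1, by simp, by simp⟩
    · exact exists_mem_iff_of_isExposed hX hne
  -- The multiple of `g` for which `l + t • g` takes its maximum over `B` also at the apex.
  set t := (d - l a) / (g a - c) with ht
  have hta : t * (g a - c) = d - l a := div_mul_cancel₀ _ (sub_pos.2 hga).ne'
  have apply_apex : (l + t • g) a = d + t * c := by
    simp only [add_apply, smul_apply, smul_eq_mul]
    linarith
  have apply_base (y) (hy : y ∈ B) : (l + t • g) y = l y + t * c := by
    simp [hg y hy]
  refine ⟨_, isExposed_setOf_eq (l + t • g) (c := d + t * c) ((hB.pyramid a).le_of_forall_vertexSet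
    _ fun v hv => ?_), ⟨subset_convexHull ℝ _ (Set.mem_insert _ _), apply_apex⟩, ?_⟩
  · rcases hB.vertexSet_pyramid_subset a hv with rfl | hv
    · exact apply_apex.le
    · rw [apply_base v hv.1]
      gcongr
      exact hl v hv.1
  · ext y
    rw [mem_X]
    constructor
    · rintro ⟨⟨-, hy⟩, hyB⟩
      exact ⟨hyB, add_right_cancel ((apply_base y hyB).symm.trans hy)⟩
    · rintro ⟨hyB, hy⟩
      have hyP := subset_convexHull ℝ _ (Set.mem_insert_of_mem a hyB)
      exact ⟨⟨hyP, (apply_base y hyB).trans (by rw [hy])⟩, hyB⟩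

theorem isExposed_pyramid_base (hB : IsPolytope B) (ha : a ∉ affineSpan ℝ B) :
    IsExposed ℝ (convexHull ℝ (insert a B)) B := by
  obtain ⟨g, c, hg, hga⟩ := exists_forall_eq_and_lt_of_notMem_affineSpan hB.nonempty ha
  have hP := hB.pyramid a
  have hle : ∀ v ∈ vertexSet (convexHull ℝ (insert a B)), (-g) v ≤ -c := fun v hv => by
    rcases hB.vertexSet_pyramid_subset a hv with rfl | hv
    · exact neg_le_neg hga.le
    · exact (congrArg Neg.neg (hg v hv.1)).le
  have hface := isExposed_setOf_eq (-g) (hP.le_of_forall_vertexSet _ hle)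
  suffices h : {y ∈ convexHull ℝ (insert a B) | (-g) y = -c} = B by rwa [h] at hface
  refine Set.Subset.antisymm ?_ fun y hy =>
    ⟨subset_convexHull ℝ _ (Set.mem_insert_of_mem _ hy), congrArg Neg.neg (hg y hy)⟩
  rw [hP.face_eq_convexHull hface, vertexSet_eq_inter hface]
  refine convexHull_min (fun v hv => ?_) hB.convex
  rcases hB.vertexSet_pyramid_subset a hv.2 with rfl | hvB
  · exact absurd (neg_inj.1 hv.1.2) hga.ne'
  · exact hvB.1

theorem apex_mem_vertexSet_pyramid (hB : IsPolytope B) (ha : a ∉ affineSpan ℝ B) :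
    a ∈ vertexSet (convexHull ℝ (insert a B)) := by
  obtain ⟨Y, hY, haY, hYB⟩ := hB.exists_isExposed_pyramid_inter_eq ha isExposed_empty
  obtain ⟨y, hy⟩ := (hY.isCompact (hB.pyramid a).isCompact).extremePoints_nonempty ⟨a, haY⟩
  have hyP : y ∈ Y ∩ vertexSet (convexHull ℝ (insert a B)) := vertexSet_eq_inter hY ▸ hy
  rcases hB.vertexSet_pyramid_subset a hyP.2 with rfl | hyB
  · exact hyP.2
  · exact absurd (hYB.subset ⟨hyP.1, hyB.1⟩) (Set.notMem_empty y)

theorem vertexSet_pyramid (hB : IsPolytope B) (ha : a ∉ affineSpan ℝ B) :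
    vertexSet (convexHull ℝ (insert a B)) = insert a (vertexSet B) :=
  (hB.vertexSet_pyramid_subset a).antisymm <|
    Set.insert_subset (hB.apex_mem_vertexSet_pyramid ha) <|
      vertexSet_eq_inter (hB.isExposed_pyramid_base ha) ▸ Set.inter_subset_right

/-- The apex of the pyramid `conv (B ∪ {a})` as an element of its face lattice. -/
def apexFace (hB : IsPolytope B) (ha : a ∉ affineSpan ℝ B) :
    FaceLattice (convexHull ℝ (insert a B)) :=
  ⟨{a}, (hB.pyramid a).isExposed_singleton (hB.apex_mem_vertexSet_pyramid ha)⟩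

theorem isExposed_inter_base (hB : IsPolytope B) (ha : a ∉ affineSpan ℝ B)
    (hX : IsExposed ℝ (convexHull ℝ (insert a B)) X) : IsExposed ℝ B (X ∩ B) :=
  (hX.inter (hB.isExposed_pyramid_base ha)).mono (hB.isExposed_pyramid_base ha).subset
    Set.inter_subset_right

theorem vertexFinset_pyramid_of_mem (hB : IsPolytope B) (ha : a ∉ affineSpan ℝ B)
    (hX : IsExposed ℝ (convexHull ℝ (insert a B)) X) (haX : a ∈ X) :
    vertexFinset X = insert a (vertexFinset (X ∩ B)) := by
  ext v
  rw [(hB.pyramid a).mem_vertexFinset hX, hB.vertexSet_pyramid ha, Finset.mem_insert,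
    hB.mem_vertexFinset (hB.isExposed_inter_base ha hX), Set.mem_insert_iff, Set.mem_inter_iff]
  have hvB : v ∈ vertexSet B → v ∈ B := fun hv => hv.1
  have hva : v = a → v ∈ X := fun h => h ▸ haX
  tauto

theorem vertexFinset_pyramid (hB : IsPolytope B) (ha : a ∉ affineSpan ℝ B) :
    vertexFinset (convexHull ℝ (insert a B)) = insert a (vertexFinset B) := by
  rw [hB.vertexFinset_pyramid_of_mem ha (IsExposed.refl _)
    (subset_convexHull ℝ _ (Set.mem_insert a B)),
    Set.inter_eq_right.2 (hB.isExposed_pyramid_base ha).subset]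

theorem apex_notMem_vertexFinset (hB : IsPolytope B) (ha : a ∉ affineSpan ℝ B)
    (hX : IsExposed ℝ B X) : a ∉ vertexFinset X := fun h =>
  ha (subset_affineSpan ℝ B (hX.subset ((hB.mem_vertexFinset hX).1 h).1))

theorem subset_base_of_apex_notMem (hB : IsPolytope B) (ha : a ∉ affineSpan ℝ B)
    (hX : IsExposed ℝ (convexHull ℝ (insert a B)) X) (haX : a ∉ X) : X ⊆ B := by
  rw [(hB.pyramid a).subset_iff hX (hB.isExposed_pyramid_base ha), vertexSet_eq_inter hX,
    hB.vertexSet_pyramid ha]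
  rintro v ⟨hvX, rfl | hv⟩
  exacts [absurd hvX haX, hv]

theorem isCoatom_pyramid_base (hB : IsPolytope B) (ha : a ∉ affineSpan ℝ B) :
    IsCoatom (⟨B, hB.isExposed_pyramid_base ha⟩ : FaceLattice (convexHull ℝ (insert a B))) := by
  refine isCoatom_iff_ge_of_le.2 ⟨fun h => ?_, fun Y hY hBY => ?_⟩
  · have haP : a ∈ convexHull ℝ (insert a B) := subset_convexHull ℝ _ (Set.mem_insert a B)
    have hBP : B = convexHull ℝ (insert a B) := congrArg Subtype.val h
    exact ha (subset_affineSpan ℝ B (hBP.symm.subset haP))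
  · refine hB.subset_base_of_apex_notMem ha Y.2 fun haY => hY ?_
    exact Subtype.ext (Y.2.subset.antisymm
      (convexHull_min (Set.insert_subset haY hBY) (Y.2.convex (hB.pyramid a).convex)))

/-- Intersecting with the base `B` identifies the faces of the pyramid `conv (B ∪ {a})` through the
apex `a` with the faces of `B`. -/
noncomputable def pyramidIciOrderIso (hB : IsPolytope B) (ha : a ∉ affineSpan ℝ B) :
    Set.Ici (hB.apexFace ha) ≃o FaceLattice B :=
  RelIso.ofSurjective (OrderEmbedding.ofMapLEIff
    (fun Y => ⟨Y.1.1 ∩ B, hB.isExposed_inter_base ha Y.1.2⟩) fun Y Z => by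
      have hY := Set.singleton_subset_iff.1 Y.2
      have hZ := Set.singleton_subset_iff.1 Z.2
      have hsubset := (hB.vertexFinset_subset_iff (hB.isExposed_inter_base ha Y.1.2)
        (hB.isExposed_inter_base ha Z.1.2)).symm
      have hapex := hB.apex_notMem_vertexFinset ha (hB.isExposed_inter_base ha Y.1.2)
      refine hsubset.trans ((Finset.insert_subset_insert_iff hapex).symm.trans ?_)
      rw [← hB.vertexFinset_pyramid_of_mem ha Y.1.2 hY,
        ← hB.vertexFinset_pyramid_of_mem ha Z.1.2 hZ]
      exact (hB.pyramid a).vertexFinset_subset_iff Y.1.2 Z.1.2) fun X => by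
    obtain ⟨Y, hY, haY, hYB⟩ := hB.exists_isExposed_pyramid_inter_eq ha X.2
    exact ⟨⟨⟨Y, hY⟩, Set.singleton_subset_iff.2 haY⟩, Subtype.ext hYB⟩

theorem facetFamily_pyramid (hB : IsPolytope B) (ha : a ∉ affineSpan ℝ B) :
    facetFamily (convexHull ℝ (insert a B)) =
      insert (vertexFinset B) (insert a '' facetFamily B) := by
  have isCoatom_iff (Y : Set.Ici (hB.apexFace ha)) :
      IsCoatom Y.1 ↔ IsCoatom (hB.pyramidIciOrderIso ha Y) :=
    ⟨fun h => (OrderIso.isCoatom_iff _ _).2 (h.Ici Y.2),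
      fun h => ((OrderIso.isCoatom_iff _ _).1 h).of_isCoatom_coe_Ici⟩
  have vertexFinset_eq (Y : Set.Ici (hB.apexFace ha)) :
      vertexFinset Y.1.1 = insert a (vertexFinset (hB.pyramidIciOrderIso ha Y).1) :=
    hB.vertexFinset_pyramid_of_mem ha Y.1.2 (Set.singleton_subset_iff.1 Y.2)
  ext E
  constructor
  · rintro ⟨Y, hY, rfl⟩
    by_cases haY : a ∈ Y.1
    · let Y' : Set.Ici (hB.apexFace ha) := ⟨Y, Set.singleton_subset_iff.2 haY⟩
      exact Or.inr ⟨_, ⟨_, (isCoatom_iff Y').1 hY, rfl⟩, (vertexFinset_eq Y').symm⟩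
    · have hYB : (⟨B, hB.isExposed_pyramid_base ha⟩ : FaceLattice _) = Y :=
        (hY.le_iff_eq (hB.isCoatom_pyramid_base ha).1).1
          (hB.subset_base_of_apex_notMem ha Y.2 haY)
      exact Or.inl (hYB ▸ rfl)
  · rintro (rfl | ⟨_, ⟨X, hX, rfl⟩, rfl⟩)
    · exact ⟨_, hB.isCoatom_pyramid_base ha, rfl⟩
    · obtain ⟨Y, rfl⟩ := (hB.pyramidIciOrderIso ha).surjective X
      exact ⟨Y, (isCoatom_iff Y).2 hX, vertexFinset_eq Y⟩

end IsPolytope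

end Pyramids

section P5812

open scoped Matrix

/-- The coordinates of the vertices of `P5812`. -/
def p5812Coord : Fin 8 → Fin 5 → ℤ :=
  ![![0, 0, 0, 0, 0], ![0, 0, 0, 0, 1], ![0, 0, 0, 1, 0], ![0, 0, 1, 0, 0], ![0, 1, 0, 0, 1],
    ![0, 1, 1, 1, 0], ![1, 0, 0, 1, 0], ![1, 0, 1, 0, 1]]

/-- The vertices of `P5812`. -/
noncomputable def p5812Vertex (i : Fin 8) : EuclideanSpace ℝ (Fin 5) :=
  WithLp.toLp 2 fun j => (p5812Coord i j : ℝ)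

/-- The vertex sets of the facets of `P5812`. -/
def p5812Facet : Fin 12 → Finset (Fin 8) :=
  ![{0, 1, 2, 3, 4, 5}, {0, 1, 2, 3, 6, 7}, {0, 3, 4, 5, 6, 7}, {1, 2, 4, 5, 6, 7},
    {0, 1, 2, 4, 6}, {0, 1, 3, 4, 7}, {0, 1, 4, 6, 7}, {0, 2, 3, 5, 6}, {0, 2, 4, 5, 6},
    {1, 2, 3, 5, 7}, {1, 3, 4, 5, 7}, {2, 3, 5, 6, 7}]

/-- The coefficients of the functionals that are maximal on the facets of `P5812`. -/
def p5812Normal : Fin 12 → Fin 5 → ℤ :=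
  ![![-1, 0, 0, 0, 0], ![0, -1, 0, 0, 0], ![1, 1, 0, -1, -1], ![0, 0, 0, 1, 1],
    ![0, 0, -1, 0, 0], ![0, 0, 0, -1, 0], ![1, 0, -1, -1, 0], ![0, 0, 0, 0, -1],
    ![0, 1, -1, 0, -1], ![-1, -1, 1, 1, 1], ![-1, 0, 1, 0, 1], ![0, -1, 1, 1, 0]]

/-- The maxima over `P5812` of the functionals given by `p5812Normal`. -/
def p5812Bound : Fin 12 → ℤ := ![0, 0, 0, 1, 0, 0, 0, 0, 0, 1, 1, 1]

theorem p5812Normal_dotProduct_le :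
    ∀ j i, p5812Normal j ⬝ᵥ p5812Coord i ≤ p5812Bound j := by decide

theorem p5812Normal_dotProduct_eq_iff :
    ∀ j i, p5812Normal j ⬝ᵥ p5812Coord i = p5812Bound j ↔ i ∈ p5812Facet j := by decide

theorem signVector_dotProduct_p5812Coord_le : ∀ i i',
    (fun j => 2 * p5812Coord i j - 1) ⬝ᵥ p5812Coord i' ≤ ∑ j, p5812Coord i j := by decide

theorem signVector_dotProduct_p5812Coord_eq_iff : ∀ i i',
    (fun j => 2 * p5812Coord i j - 1) ⬝ᵥ p5812Coord i' = ∑ j, p5812Coord i j ↔ i' = i := by decide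

theorem p5812Facet_subset_iff : ∀ i j, p5812Facet i ⊆ p5812Facet j ↔ i = j := by decide

theorem p5812Facet_ssubset_univ : ∀ j, p5812Facet j ⊂ Finset.univ := by decide

set_option maxRecDepth 10000 in
theorem exists_p5812Facet_adjacent : ∀ i j, ∃ t, t ≠ i ∧ t ≠ j ∧ (p5812Facet t).card = 6 ∧
    ∀ s, p5812Facet i ∩ p5812Facet t ⊆ p5812Facet s → s = i ∨ s = t := by decide

theorem card_p5812Facet_inter_le : ∀ i j, i ≠ j → (p5812Facet i).card = 6 →
    (p5812Facet j).card = 6 → (p5812Facet i ∩ p5812Facet j).card ≤ 4 := by decide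

theorem p5812Facet_injective : Function.Injective p5812Facet := fun i j h =>
  (p5812Facet_subset_iff i j).1 h.subset

theorem largeFacetIncidence_p5812Facet :
    LargeFacetIncidence 8 12 Finset.univ (Set.range p5812Facet) where
  card_eq := by simp
  ssubset := by
    rintro _ ⟨j, rfl⟩
    exact p5812Facet_ssubset_univ j
  antichain := by
    rintro _ ⟨i, rfl⟩ _ ⟨j, rfl⟩ h
    rw [(p5812Facet_subset_iff i j).1 h]
  le_encard := by
    rw [← Set.image_univ, p5812Facet_injective.encard_image]
    simp
  exists_adjacent := by
    rintro _ ⟨i, rfl⟩ _ ⟨j, rfl⟩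
    obtain ⟨t, hi, hj, hc, hadj⟩ := exists_p5812Facet_adjacent i j
    refine ⟨_, ⟨t, rfl⟩, p5812Facet_injective.ne hi, p5812Facet_injective.ne hj, by rw [hc], ?_⟩
    rintro _ ⟨s, rfl⟩ hs
    exact (hadj s hs).imp (congrArg p5812Facet) (congrArg p5812Facet)
  card_inter_le := by
    rintro _ ⟨i, rfl⟩ _ ⟨j, rfl⟩ hne hi hj
    have := card_p5812Facet_inter_le i j (fun h => hne (h ▸ rfl)) (by omega) (by omega)
    omega

set_option maxRecDepth 100000 in
theorem forall_or_exists_p5812Facet_of_iff : ∀ z : Fin 8 → Bool,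
    (z 0 ∧ z 1 ∧ z 5 ↔ z 2 ∧ z 3 ∧ z 4) → (z 0 ∧ z 2 ∧ z 7 ↔ z 1 ∧ z 3 ∧ z 6) →
    (z 0 ∧ z 5 ∧ z 7 ↔ z 3 ∧ z 4 ∧ z 6) → (z 1 ∧ z 5 ∧ z 6 ↔ z 2 ∧ z 4 ∧ z 7) →
    (∀ i, z i) ∨ ∃ j, ∀ i, z i → i ∈ p5812Facet j := by
  decide

/-
The two relations and their sum and difference
`2 u₀ + u₅ + u₇ = 2 u₃ + u₄ + u₆`, `2 u₁ + u₅ + u₆ = 2 u₂ + u₄ + u₇`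
equate sums of nonnegative numbers, so one side vanishes termwise iff the other does; these four
equivalences already confine the zeros of `u`.
-/
theorem forall_eq_zero_or_exists_p5812Facet {u : Fin 8 → ℝ} (hu : ∀ i, 0 ≤ u i)
    (h₁ : u 0 + u 1 + u 5 = u 2 + u 3 + u 4) (h₂ : u 0 + u 2 + u 7 = u 1 + u 3 + u 6) :
    (∀ i, u i = 0) ∨ ∃ j, ∀ i, u i = 0 → i ∈ p5812Facet j := by
  have h0 := hu 0
  have h1 := hu 1
  have h2 := hu 2
  have h3 := hu 3
  have h4 := hu 4
  have h5 := hu 5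
  have h6 := hu 6
  have h7 := hu 7
  have hzeros := forall_or_exists_p5812Facet_of_iff fun i => decide (u i = 0)
  simp only [decide_eq_true_eq] at hzeros
  apply hzeros <;> constructor <;> rintro ⟨_, _, _⟩ <;> refine ⟨?_, ?_, ?_⟩ <;> linarith

theorem P5812_eq_convexHull_range : P5812 = convexHull ℝ (Set.range p5812Vertex) := by
  have vertex_eq : p5812Vertex = ![!₂[0, 0, 0, 0, 0], !₂[0, 0, 0, 0, 1], !₂[0, 0, 0, 1, 0],
      !₂[0, 0, 1, 0, 0], !₂[0, 1, 0, 0, 1], !₂[0, 1, 1, 1, 0], !₂[1, 0, 0, 1, 0],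
      !₂[1, 0, 1, 0, 1]] := by
    ext i j
    fin_cases i <;> fin_cases j <;> simp [p5812Vertex, p5812Coord]
  rw [vertex_eq]
  simp only [P5812, Matrix.range_cons, Matrix.range_empty, Set.union_empty, Set.singleton_union]

theorem isPolytope_P5812 : IsPolytope P5812 :=
  ⟨_, Set.finite_range _, Set.range_nonempty _, P5812_eq_convexHull_range⟩

theorem p5812Vertex_mem_P5812 (i : Fin 8) : p5812Vertex i ∈ P5812 :=
  P5812_eq_convexHull_range ▸ subset_convexHull ℝ _ (Set.mem_range_self i)

theorem vertexSet_P5812_subset : vertexSet P5812 ⊆ Set.range p5812Vertex :=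
  P5812_eq_convexHull_range ▸ extremePoints_convexHull_subset

theorem exists_isExposed_P5812 (w : Fin 5 → ℤ) (b : ℤ) (h : ∀ i, w ⬝ᵥ p5812Coord i ≤ b) :
    ∃ X, IsExposed ℝ P5812 X ∧ ∀ i, p5812Vertex i ∈ X ↔ w ⬝ᵥ p5812Coord i = b := by
  let l : StrongDual ℝ (EuclideanSpace ℝ (Fin 5)) := ∑ j, (w j : ℝ) • EuclideanSpace.proj j
  have apply_vertex (i) : l (p5812Vertex i) = (w ⬝ᵥ p5812Coord i : ℤ) := by
    simp [l, p5812Vertex, dotProduct]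
  refine ⟨_, isExposed_setOf_eq l (c := b) (isPolytope_P5812.le_of_forall_vertexSet l
    fun v hv => ?_), fun i => ?_⟩
  · obtain ⟨i, rfl⟩ := vertexSet_P5812_subset hv
    rw [apply_vertex]
    exact_mod_cast h i
  · rw [Set.mem_ofPred_eq, apply_vertex, and_iff_right (p5812Vertex_mem_P5812 i), Int.cast_inj]

theorem exists_isExposed_P5812_mem_iff_eq (i : Fin 8) :
    ∃ X, IsExposed ℝ P5812 X ∧ ∀ i', p5812Vertex i' ∈ X ↔ i' = i := by
  obtain ⟨X, hX, mem_X⟩ := exists_isExposed_P5812 _ _ (signVector_dotProduct_p5812Coord_le i)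
  exact ⟨X, hX, fun i' => (mem_X i').trans (signVector_dotProduct_p5812Coord_eq_iff i i')⟩

theorem p5812Vertex_injective : Function.Injective p5812Vertex := fun i i' h => by
  obtain ⟨X, -, mem_X⟩ := exists_isExposed_P5812_mem_iff_eq i'
  rw [← mem_X, h, mem_X]

theorem vertexSet_P5812 : vertexSet P5812 = Set.range p5812Vertex := by
  refine vertexSet_P5812_subset.antisymm ?_
  rintro _ ⟨i, rfl⟩
  obtain ⟨X, hX, mem_X⟩ := exists_isExposed_P5812_mem_iff_eq i
  obtain ⟨y, hy⟩ := (hX.isCompact isPolytope_P5812.isCompact).extremePoints_nonempty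
    ⟨_, (mem_X i).2 rfl⟩
  have hyX : y ∈ X ∩ vertexSet P5812 := vertexSet_eq_inter hX ▸ hy
  obtain ⟨i', rfl⟩ := vertexSet_P5812_subset hyX.2
  exact (mem_X i').1 hyX.1 ▸ hyX.2

theorem p5812Vertex_add_eq :
    p5812Vertex 0 + p5812Vertex 1 + p5812Vertex 5 =
        p5812Vertex 2 + p5812Vertex 3 + p5812Vertex 4 ∧
      p5812Vertex 0 + p5812Vertex 2 + p5812Vertex 7 =
        p5812Vertex 1 + p5812Vertex 3 + p5812Vertex 6 := by
  constructor <;> ext j <;> fin_cases j <;> simp [p5812Vertex, p5812Coord]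

theorem isExposed_P5812_subset_iff {X Y : Set (EuclideanSpace ℝ (Fin 5))}
    (hX : IsExposed ℝ P5812 X) (hY : IsExposed ℝ P5812 Y) :
    X ⊆ Y ↔ ∀ i, p5812Vertex i ∈ X → p5812Vertex i ∈ Y := by
  refine ⟨fun h i hi => h hi, fun h => ?_⟩
  rw [isPolytope_P5812.subset_iff hX hY, vertexSet_eq_inter hX, vertexSet_eq_inter hY,
    vertexSet_P5812]
  rintro _ ⟨hiX, i, rfl⟩
  exact ⟨h i hiX, i, rfl⟩

theorem exists_p5812Facet_of_isExposed {X : Set (EuclideanSpace ℝ (Fin 5))}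
    (hX : IsExposed ℝ P5812 X) (hXP : X ≠ P5812) :
    ∃ j, ∀ i, p5812Vertex i ∈ X → i ∈ p5812Facet j := by
  rcases X.eq_empty_or_nonempty with rfl | hne
  · exact ⟨0, fun i hi => absurd hi (Set.notMem_empty _)⟩
  obtain ⟨l, c, hl, mem_X⟩ := exists_mem_iff_of_isExposed hX hne
  have vertex_mem_X (i) : p5812Vertex i ∈ X ↔ c - l (p5812Vertex i) = 0 := by
    rw [mem_X, and_iff_right (p5812Vertex_mem_P5812 i), sub_eq_zero, eq_comm]
  have h₁ := congrArg l p5812Vertex_add_eq.1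
  have h₂ := congrArg l p5812Vertex_add_eq.2
  simp only [map_add] at h₁ h₂
  simp only [vertex_mem_X]
  refine (forall_eq_zero_or_exists_p5812Facet (u := fun i => c - l (p5812Vertex i))
    (fun i => sub_nonneg.2 (hl _ (p5812Vertex_mem_P5812 i))) (by linarith) (by linarith)
    ).resolve_left fun h => hXP ?_
  exact hX.subset.antisymm <| (isExposed_P5812_subset_iff (IsExposed.refl _) hX).2
    fun i _ => (vertex_mem_X i).2 (h i)

theorem exists_faces_P5812 : ∃ F : Fin 12 → FaceLattice P5812,
    (∀ j i, p5812Vertex i ∈ (F j).1 ↔ i ∈ p5812Facet j) ∧ (∀ j, IsCoatom (F j)) ∧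
      ∀ X, IsCoatom X → ∃ j, X = F j := by
  choose F hF mem_F using fun j => exists_isExposed_P5812 _ _ (p5812Normal_dotProduct_le j)
  replace mem_F (j i) : p5812Vertex i ∈ F j ↔ i ∈ p5812Facet j :=
    (mem_F j i).trans (p5812Normal_dotProduct_eq_iff j i)
  have exists_le (X : FaceLattice P5812) (hX : X ≠ ⊤) : ∃ j, X.1 ⊆ F j := by
    obtain ⟨j, hj⟩ := exists_p5812Facet_of_isExposed X.2 fun h => hX (Subtype.ext h)
    exact ⟨j, (isExposed_P5812_subset_iff X.2 (hF j)).2 fun i hi => (mem_F j i).2 (hj i hi)⟩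
  have ne_top (j) : (⟨F j, hF j⟩ : FaceLattice P5812) ≠ ⊤ := fun h =>
    (p5812Facet_ssubset_univ j).ne <| Finset.eq_univ_of_forall fun i => by
      have hFj : F j = P5812 := congrArg Subtype.val h
      exact (mem_F j i).1 (hFj ▸ p5812Vertex_mem_P5812 i)
  refine ⟨fun j => ⟨F j, hF j⟩, mem_F, fun j => isCoatom_iff_ge_of_le.2
    ⟨ne_top j, fun Y hY hjY => ?_⟩, fun X hX => ?_⟩
  · obtain ⟨j', hj'⟩ := exists_le Y hY
    have hjj' : j = j' := (p5812Facet_subset_iff j j').1 fun i hi =>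
      (mem_F j' i).1 (hj' (hjY ((mem_F j i).2 hi)))
    exact hjj' ▸ hj'
  · obtain ⟨j, hj⟩ := exists_le X hX.1
    exact ⟨j, ((hX.le_iff_eq (ne_top j)).1 hj).symm⟩

theorem vertexFinset_P5812_face {X : Set (EuclideanSpace ℝ (Fin 5))} (hX : IsExposed ℝ P5812 X)
    {S : Finset (Fin 8)} (mem_X : ∀ i, p5812Vertex i ∈ X ↔ i ∈ S) :
    vertexFinset X = S.image p5812Vertex := by
  ext v
  rw [isPolytope_P5812.mem_vertexFinset hX, vertexSet_P5812, Finset.mem_image]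
  constructor
  · rintro ⟨hv, i, rfl⟩
    exact ⟨i, (mem_X i).1 hv, rfl⟩
  · rintro ⟨i, hi, rfl⟩
    exact ⟨(mem_X i).2 hi, i, rfl⟩

theorem vertexFinset_P5812 : vertexFinset P5812 = Finset.univ.image p5812Vertex :=
  vertexFinset_P5812_face (IsExposed.refl _) fun i => by simp [p5812Vertex_mem_P5812 i]

theorem facetFamily_P5812 :
    facetFamily P5812 = Finset.image p5812Vertex '' Set.range p5812Facet := by
  obtain ⟨F, mem_F, isCoatom_F, exists_eq⟩ := exists_faces_P5812
  have vertexFinset_F (j) := vertexFinset_P5812_face (F j).2 (mem_F j)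
  rw [← Set.range_comp]
  ext E
  constructor
  · rintro ⟨X, hX, rfl⟩
    obtain ⟨j, rfl⟩ := exists_eq X hX
    exact ⟨j, (vertexFinset_F j).symm⟩
  · rintro ⟨j, rfl⟩
    exact ⟨F j, isCoatom_F j, vertexFinset_F j⟩

theorem largeFacetIncidence_P5812 :
    LargeFacetIncidence 8 12 (vertexFinset P5812) (facetFamily P5812) := by
  rw [vertexFinset_P5812, facetFamily_P5812]
  exact largeFacetIncidence_p5812Facet.map p5812Vertex_injective.injOn

end P5812

section PyramidsOverFacets

variable {m n : ℕ} {N f k : ℕ} {P B : Set (EuclideanSpace ℝ (Fin n))}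
  {Q R : Set (EuclideanSpace ℝ (Fin m))} {a : EuclideanSpace ℝ (Fin n)}

theorem CombEquiv.symm (h : CombEquiv P Q) : CombEquiv Q P :=
  h.map OrderIso.symm

theorem CombEquiv.exists_mem_facetFamily_card_eq (h : CombEquiv Q P) (hQ : IsPolytope Q)
    (hP : IsPolytope P) {S : Finset (EuclideanSpace ℝ (Fin m))} (hS : S ∈ facetFamily Q) :
    ∃ T ∈ facetFamily P, T.card = S.card := by
  obtain ⟨φ, hφ, -, hfacet⟩ := h.exists_image_facetFamily hQ hP
  refine ⟨S.image φ, hfacet ▸ ⟨S, hS, rfl⟩, Finset.card_image_of_injOn (hφ.mono ?_)⟩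
  obtain ⟨X, -, rfl⟩ := hS
  exact (hQ.vertexFinset_subset_iff X.2 (IsExposed.refl Q)).2 X.2.subset

theorem CombEquiv.largeFacetIncidence (h : CombEquiv Q P) (hQ : IsPolytope Q) (hP : IsPolytope P)
    (hinc : LargeFacetIncidence N f (vertexFinset Q) (facetFamily Q)) :
    LargeFacetIncidence N f (vertexFinset P) (facetFamily P) := by
  obtain ⟨φ, hφ, hvertex, hfacet⟩ := h.exists_image_facetFamily hQ hP
  rw [hvertex, hfacet]
  exact hinc.map hφ

theorem IsPyramidWithBase.isPolytope (h : IsPyramidWithBase P B) : IsPolytope P := by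
  obtain ⟨hB, a, -, rfl⟩ := h
  exact hB.pyramid a

theorem IsPyramidWithBase.vertexFinset_base_mem (h : IsPyramidWithBase P B) :
    vertexFinset B ∈ facetFamily P := by
  obtain ⟨hB, a, ha, rfl⟩ := h
  exact hB.facetFamily_pyramid ha ▸ Set.mem_insert _ _

theorem IsPolytope.facetFamily_nonempty (hP : IsPolytope P) : (facetFamily P).Nonempty := by
  obtain ⟨x, hx⟩ := hP.nonempty
  obtain ⟨H, hH, -, -⟩ := hP.exists_isCoatom_ge ⊥ hx (Set.notMem_empty x)
  exact ⟨_, H, hH, rfl⟩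

theorem IsPyramidWithBase.largeFacetIncidence (h : IsPyramidWithBase P B)
    (hinc : LargeFacetIncidence N f (vertexFinset B) (facetFamily B)) :
    LargeFacetIncidence (N + 1) (f + 1) (vertexFinset P) (facetFamily P) := by
  obtain ⟨hB, a, ha, rfl⟩ := h
  rw [hB.vertexFinset_pyramid ha, hB.facetFamily_pyramid ha]
  exact hinc.pyramid hB.facetFamily_nonempty (hB.apex_notMem_vertexFinset ha (IsExposed.refl B))

theorem IsKFoldPyramidOver.isPolytope : IsKFoldPyramidOver R k P → IsPolytope P := by
  cases k with
  | zero => exact And.left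
  | succ k =>
    rintro ⟨B, hB, -⟩
    exact hB.isPolytope

theorem IsKFoldPyramidOver.largeFacetIncidence (h : IsKFoldPyramidOver R k P) (hR : IsPolytope R)
    (hinc : LargeFacetIncidence N f (vertexFinset R) (facetFamily R)) :
    LargeFacetIncidence (N + k) (f + k) (vertexFinset P) (facetFamily P) := by
  induction k generalizing P with
  | zero => exact h.2.symm.largeFacetIncidence hR h.1 hinc
  | succ k ih =>
    obtain ⟨B, hB, hBk⟩ := h
    exact hB.largeFacetIncidence (ih hBk)

theorem notMem_affineSpan_of_isExposed (hB : IsExposed ℝ P B) (hne : B.Nonempty) (ha : a ∈ P)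
    (haB : a ∉ B) : a ∉ affineSpan ℝ B := by
  intro hspan
  obtain ⟨l, c, -, mem_B⟩ := exists_mem_iff_of_isExposed hB hne
  obtain ⟨x, hx⟩ := hne
  have hax : a -ᵥ x ∈ vectorSpan ℝ B := direction_affineSpan ℝ B ▸
    AffineSubspace.vsub_mem_direction hspan (subset_affineSpan ℝ B hx)
  have hl := map_eq_zero_of_mem_vectorSpan l.toLinearMap (fun y hy => ((mem_B y).1 hy).2) hax
  refine haB ((mem_B a).2 ⟨ha, ?_⟩)
  rw [vsub_eq_sub, map_sub, sub_eq_zero] at hl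
  exact hl.trans ((mem_B x).1 hx).2

theorem IsPolytope.isPyramidWithBase_of_vertexFinset_eq_erase (hP : IsPolytope P)
    (ha : a ∈ vertexFinset P) (hB : IsExposed ℝ P B) (hne : B.Nonempty)
    (hBa : vertexFinset B = (vertexFinset P).erase a) : IsPyramidWithBase P B := by
  have haP := (hP.mem_vertexFinset (IsExposed.refl P)).1 ha
  have haB : a ∉ B := fun haB => Finset.notMem_erase a _ <|
    hBa ▸ (hP.mem_vertexFinset hB).2 ⟨haB, haP.2⟩
  have hBp := hP.face hB hne
  refine ⟨hBp, a, notMem_affineSpan_of_isExposed hB hne haP.1 haB, ?_⟩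
  rw [← hBp.convexHull_insert_vertexSet, ← hP.coe_vertexFinset hB, hBa, ← Finset.coe_insert,
    Finset.insert_erase ha, hP.coe_vertexFinset (IsExposed.refl P), ← hP.eq_convexHull]

theorem IsTwoNeighborly.pair_mem_faceFamily (h : IsTwoNeighborly P) (hP : IsPolytope P) :
    ∀ x ∈ vertexFinset P, ∀ y ∈ vertexFinset P, x ≠ y → {x, y} ∈ faceFamily P := by
  intro x hx y hy hxy
  rw [hP.mem_vertexFinset (IsExposed.refl P)] at hx hy
  have hseg := h x hx.2 y hy.2 hxy
  refine ⟨⟨_, hseg⟩, ?_⟩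
  ext z
  rw [hP.mem_vertexFinset hseg, Finset.mem_insert, Finset.mem_singleton]
  constructor
  · rintro ⟨hz, hzP⟩
    exact ((mem_extremePoints_iff_forall_segment.1 hzP).2 x hx.1 y hy.1 hz).imp Eq.symm Eq.symm
  · rintro (rfl | rfl)
    exacts [⟨left_mem_segment ℝ _ _, hx.2⟩, ⟨right_mem_segment ℝ _ _, hy.2⟩]

theorem IsPolytope.le_encard_vertexSet_iff (hP : IsPolytope P) (hB : IsExposed ℝ P B) :
    (N : ℕ∞) ≤ (vertexSet B).encard ↔ N ≤ (vertexFinset B).card := by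
  rw [← hP.coe_vertexFinset hB, Set.encard_coe_eq_coe_finsetCard, Nat.cast_le]

theorem IsTwoNeighborly.isPyramidOver (hneigh : IsTwoNeighborly P) (hP : IsPolytope P)
    (hd : 2 ≤ affDim P) (hQ : IsPolytope Q)
    (hinc : LargeFacetIncidence N f (vertexFinset Q) (facetFamily Q))
    (hbase : ∃ S ∈ facetFamily Q, S.card + 1 = N) (hfacets : (facetSet P).encard ≤ f + 3)
    (hlarge : ∃ F ∈ facetSet P, (N : ℕ∞) ≤ (vertexSet F).encard)
    (hequiv : ∀ F ∈ facetSet P, (N : ℕ∞) ≤ (vertexSet F).encard → CombEquiv F Q) :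
    IsPyramidOver P Q := by
  have facets_eq : facets (faceFamily P) (vertexFinset P) = vertexFinset '' facetSet P := by
    rw [hP.facets_faceFamily (IsExposed.refl P), hP.facetFamily_eq_image_facetSet (by omega)]
  have combEquiv {F} (hF : F ∈ facetSet P) (hFN : N ≤ (vertexFinset F).card) : CombEquiv Q F :=
    (hequiv F hF ((hP.le_encard_vertexSet_iff hF.1).2 hFN)).symm
  obtain ⟨F, hF, hFN⟩ := hlarge
  rw [hP.le_encard_vertexSet_iff hF.1] at hFN
  have hF_mem : vertexFinset F ∈ facets (faceFamily P) (vertexFinset P) :=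
    facets_eq ▸ ⟨F, hF, rfl⟩
  obtain ⟨S, hS, hSN⟩ := hbase
  obtain ⟨E, hE, hES⟩ :=
    (combEquiv hF hFN).exists_mem_facetFamily_card_eq hQ (hP.face hF.1 hF.2.1) hS
  rw [← hP.facets_faceFamily hF.1] at hE
  obtain ⟨a, ha, haV⟩ := exists_erase_mem_facets (N := N) (f := f) (hP.isFaceFamily hd)
    (hneigh.pair_mem_faceFamily hP)
    (facets_eq ▸ (Set.encard_image_le _ _).trans hfacets) (by
      rw [facets_eq]
      rintro _ ⟨H, hH, rfl⟩ hHN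
      rw [hP.facets_faceFamily hH.1]
      exact (combEquiv hH hHN).largeFacetIncidence hQ (hP.face hH.1 hH.2.1) hinc)
    hF_mem hFN hE (by rw [hES, hSN])
  have hcard := Finset.card_lt_card (ssubset_of_mem_facets hF_mem)
  obtain ⟨B, hB, hBa⟩ := facets_eq ▸ haV
  refine ⟨B, hP.isPyramidWithBase_of_vertexFinset_eq_erase ha hB.1 hB.2.1 hBa, hequiv B hB ?_⟩
  rw [hP.le_encard_vertexSet_iff hB.1, hBa, Finset.card_erase_of_mem ha]
  omega

end PyramidsOverFacets

theorem mainTheorem8 (k : ℕ) (hk : 1 ≤ k) (m n : ℕ)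
    (Q : Set (EuclideanSpace ℝ (Fin m))) (hQ : IsKFoldPyramidOver P5812 k Q)
    (P : Set (EuclideanSpace ℝ (Fin n))) (hP : IsDPolytope (k + 6) P)
    (hneigh : IsTwoNeighborly P)
    (hfacets : (facetSet P).encard ≤ ((k + 15 : ℕ) : ℕ∞))
    (hlarge : ∃ F ∈ facetSet P, ((k + 8 : ℕ) : ℕ∞) ≤ (vertexSet F).encard)
    (hequiv : ∀ F ∈ facetSet P, ((k + 8 : ℕ) : ℕ∞) ≤ (vertexSet F).encard → CombEquiv F Q) :
    IsPyramidOver P Q := by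
  obtain ⟨k, rfl⟩ := Nat.exists_eq_add_of_le' hk
  have hinc := hQ.largeFacetIncidence isPolytope_P5812 largeFacetIncidence_P5812
  obtain ⟨B, hB, hBk⟩ := id hQ
  have hBinc := hBk.largeFacetIncidence isPolytope_P5812 largeFacetIncidence_P5812
  rw [Nat.add_comm 8, Nat.add_comm 12] at hinc
  refine hneigh.isPyramidOver hP.1 (by rw [hP.2]; omega) hQ.isPolytope hinc
    ⟨_, hB.vertexFinset_base_mem, ?_⟩ ?_ hlarge hequiv
  · rw [hBinc.card_eq]
    omega
  · exact_mod_cast hfacets
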